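/- Let $d\in(0,\infty]$, let $f,g:\mathbb R\to\mathbb R$ be continuous on $(-d,d)$, and put $F(x)=\int_0^x f(u)\,du$, $G(x)=\int_0^x g(u)\,du$. Consider the Liénard equation $$\ddot x+f(x)\dot x+g(x)=0,\qquad |x|<d,\tag{1}$$ and the Liénard system $\dot x=y-F(x),\ \dot y=-g(x)$ on $(-d,d)\times\mathbb R$. A limit cycle is an isolated (nonconstant) periodic orbit in $(-d,d)\times\mathbb R$; its amplitude is the maximum of $|x|$ on it. For $0<\alpha<d$ put $Q=Q(\alpha)=(\alpha,F(\alpha))$. Follow the orbit of the Liénard system through $Q$, within $x>0$, backward and forward until it first meets the $y$-axis. If the backward meeting point is $Y=(0,y_+(0))$ with $y_+(0)>0$, we say that $y_+(0)$ is defined for $\alpha$; if the forward meeting point is $Y'=(0,y_-(0))$ with $y_-(0)<0$, we say that $y_-(0)$ is defined for $\alpha$. With $v(x,y)=G(x)+\tfrac12y^2$ write $V_{YQ}=v(Q)-v(Y)$ and $V_{QY'}=v(Y')-v(Q)$. Let $\alpha'$ be a root of $G(\alpha)=\tfrac12y_+(0)^2-\tfrac12F(\alpha)^2$ (that is, $V_{YQ}=0$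 for $Q=Q(\alpha')$), and $\alpha''$ a root of $G(\alpha)=\tfrac12y_-(0)^2-\tfrac12F(\alpha)^2$ (that is, $V_{QY'}=0$ for $Q=Q(\alpha'')$), where $y_\pm(0)$ belong to the orbit through $Q(\alpha)$. We say that $\bar\alpha=\max\{\alpha',\alpha''\}$ is admissible if on the orbit through $Q(\bar\alpha)$, for which $y_\pm(0)$ are both defined, either $V_{YQ}=0$ and $V_{QY'}\le 0$, or $V_{QY'}=0$ and $V_{YQ}\le 0$. Theorem. Suppose that (i) $f$ and $g$ are continuous on $(-d,d)$; (ii) $F$ and $g$ are odd on $(-d,d)$, and $g(x)>0$ for $0<x<d$; (iii) the zeros of $F$ in $(-d,d)$ are exactly $0,a,-a$, for some $a$ with $0<a<d$; (iv) there is an admissible $\bar\alpha$, as above, such that $F$ is (strictly) increasing on $(a,\bar\alpha]$ and nondecreasing on $(\bar\alpha,d)$. Then equation (1) has a unique limit cycle, both in the Liénard plane, as an orbit of the Liénard system, and in the phase plane $(x,\dot x)$, and its amplitude is at most $\bar\alpha$. (No growth of $F$ is required: for $d=\infty$, $F$ may stay bounded as $x\to\infty$.) -/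

import Mathlib

open Set

noncomputable section

namespace Lienard

/-- The symmetric open interval `(-d, d)`; `d = ⊤` gives the whole real line. -/
def symInterval (d : EReal) : Set ℝ := {x | ((|x| : ℝ) : EReal) < d}

/-- The vertical strip `(-d, d) × ℝ` of the plane. -/
def strip (d : EReal) : Set (ℝ × ℝ) := {p | p.1 ∈ symInterval d}

/-- The primitive `x ↦ ∫₀ˣ h(u) du`. With `h = f` this is `F`, with `h = g` this is `G`. -/
def primitive (h : ℝ → ℝ) (x : ℝ) : ℝ := ∫ u in (0 : ℝ)..x, h u

/-- The vector field of the Liénard system `x' = y - F(x)`, `y' = -g(x)` in the Liénard plane. -/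
def lienardField (f g : ℝ → ℝ) (p : ℝ × ℝ) : ℝ × ℝ := (p.2 - primitive f p.1, -g p.1)

/-- The vector field `x' = u`, `u' = -f(x) u - g(x)` of the equation `x'' + f(x) x' + g(x) = 0`
in the `(x, x')` phase plane. -/
def phaseField (f g : ℝ → ℝ) (p : ℝ × ℝ) : ℝ × ℝ := (p.2, -f p.1 * p.2 - g p.1)

/-- `C` is the orbit of a nonconstant periodic solution of `γ' = X(γ)` which stays in `U`. -/
def IsPeriodicOrbit (X : ℝ × ℝ → ℝ × ℝ) (U C : Set (ℝ × ℝ)) : Prop :=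
  ∃ γ : ℝ → ℝ × ℝ,
    (∀ t, γ t ∈ U ∧ HasDerivAt γ (X (γ t)) t) ∧
    (∃ T : ℝ, 0 < T ∧ Function.Periodic γ T) ∧
    (∃ s t, γ s ≠ γ t) ∧
    C = range γ

/-- A limit cycle: an isolated periodic orbit. -/
def IsLimitCycle (X : ℝ × ℝ → ℝ × ℝ) (U C : Set (ℝ × ℝ)) : Prop :=
  IsPeriodicOrbit X U C ∧
    ∃ N : Set (ℝ × ℝ), IsOpen N ∧ C ⊆ N ∧ ∀ C', IsPeriodicOrbit X U C' → C' ⊆ N → C' = C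

/-- The amplitude of a curve is the maximum of `|x|` on it. -/
def IsAmplitude (C : Set (ℝ × ℝ)) (A : ℝ) : Prop :=
  IsGreatest ((fun p : ℝ × ℝ => |p.1|) '' C) A

/-- The energy `v(x, y) = G(x) + y² / 2`. -/
def energy (g : ℝ → ℝ) (p : ℝ × ℝ) : ℝ := primitive g p.1 + p.2 ^ 2 / 2

/-- The point `Q = (α, F(α))` of the curve `y = F(x)`. -/
def curvePoint (f : ℝ → ℝ) (α : ℝ) : ℝ × ℝ := (α, primitive f α)

/-- `γ`, restricted to `[0, T]`, is a path of the Liénard system inside the strip. -/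
def IsPath (f g : ℝ → ℝ) (d : EReal) (T : ℝ) (γ : ℝ → ℝ × ℝ) : Prop :=
  0 < T ∧ ∀ t ∈ Icc 0 T,
    γ t ∈ strip d ∧ HasDerivWithinAt γ (lienardField f g (γ t)) (Icc 0 T) t

/-- `y = y₊(0)` for the path through `Q = (α, F(α))`: going back in time from `Q` within `x > 0`,
the path first meets the `y`-axis at `Y = (0, y)`, a point of the positive half axis. -/
def IsUpperIntercept (f g : ℝ → ℝ) (d : EReal) (α y : ℝ) : Prop :=
  0 < y ∧ ∃ T γ, IsPath f g d T γ ∧ γ 0 = (0, y) ∧ γ T = curvePoint f α ∧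
    ∀ t ∈ Ioc 0 T, 0 < (γ t).1

/-- `y = y₋(0)` for the path through `Q = (α, F(α))`: going forward in time from `Q` within
`x > 0`, the path first meets the `y`-axis at `Y' = (0, y)`, a point of the negative half axis. -/
def IsLowerIntercept (f g : ℝ → ℝ) (d : EReal) (α y : ℝ) : Prop :=
  y < 0 ∧ ∃ T γ, IsPath f g d T γ ∧ γ 0 = curvePoint f α ∧ γ T = (0, y) ∧
    ∀ t ∈ Ico 0 T, 0 < (γ t).1

/-- `α'` is a root of `G(α) = y₊(0)² / 2 - F(α)² / 2`, where `y₊(0)` belongs to the path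
through `(α, F(α))`. -/
def IsUpperRoot (f g : ℝ → ℝ) (d : EReal) (α' : ℝ) : Prop :=
  ∃ y, IsUpperIntercept f g d α' y ∧
    primitive g α' = y ^ 2 / 2 - primitive f α' ^ 2 / 2

/-- `α''` is a root of `G(α) = y₋(0)² / 2 - F(α)² / 2`, where `y₋(0)` belongs to the path
through `(α, F(α))`. -/
def IsLowerRoot (f g : ℝ → ℝ) (d : EReal) (α'' : ℝ) : Prop :=
  ∃ y, IsLowerIntercept f g d α'' y ∧
    primitive g α'' = y ^ 2 / 2 - primitive f α'' ^ 2 / 2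

/-- `αbar = max {α', α''}`, where `α'` is a root of the first and `α''` a root of the second
equation, and where, on the path `Y Q Y'` through `Q = (αbar, F(αbar))`, neither of the energy
differences `V_{YQ} = v(Q) - v(Y)` and `V_{QY'} = v(Y') - v(Q)` is positive. As one of them is zero
at the larger root, this says that there `V_{YQ} = 0` and `V_{QY'} ≤ 0`, or `V_{QY'} = 0` and
`V_{YQ} ≤ 0`. -/
def IsAlphaBar (f g : ℝ → ℝ) (d : EReal) (αbar : ℝ) : Prop :=
  (∃ α' α'', IsUpperRoot f g d α' ∧ IsLowerRoot f g d α'' ∧ αbar = max α' α'') ∧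
  ∃ yp ym, IsUpperIntercept f g d αbar yp ∧ IsLowerIntercept f g d αbar ym ∧
    energy g (curvePoint f αbar) - energy g (0, yp) ≤ 0 ∧
    energy g (0, ym) - energy g (curvePoint f αbar) ≤ 0

end Lienard

end

/-!
In the coordinates `s = -y`, `z = G x` the part of an orbit of the Liénard system in `x ≥ 0` becomes
an arc: a solution of `dz/ds = Ψ z - s`, `Ψ = -F ∘ G⁻¹`, over an interval `[p, q]` with `z = 0` at
both ends. As the system is invariant under `P ↦ -P`, an arc over a symmetric interval `[-Y, Y]`
and its reflection form a closed orbit.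

Existence: the hypothesis on `αbar` gives an arc over `[-y₊, -y₋]` with `-y₋ ≤ y₊`. Let `Ψ` vanish
on the negative axis and put `u = z + s² / 2`, so that `u' = Ψ (u - s² / 2)`. The given arc is an
upper solution and, as `Ψ ≥ 0` near `0`, a small constant is a lower solution. Between them the
monotone Poincaré map `u(-y₊) ↦ u(y₊)` has a fixed point, and this is a symmetric arc. Since `Ψ`
need not be Lipschitz at `0`, the map is defined by the minimal solutions.

Uniqueness: of two symmetric arcs the outer one gains less of the energy `z + s² / 2` where `Ψ > 0`
and loses more of it where `Ψ ≤ 0` decreases, which is impossible as both recover their initial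
energy. Since orbits do not cross, the outermost and the innermost arc of an arbitrary periodic
orbit are symmetric, hence equal.
-/

noncomputable section

open Filter Topology

open scoped Pointwise

namespace Lienard

theorem strictMonoOn_Icc_of_deriv_pos {φ φ' : ℝ → ℝ} {a b : ℝ} (hc : ContinuousOn φ (Icc a b))
    (hd : ∀ x ∈ Ioo a b, HasDerivAt φ (φ' x) x) (hpos : ∀ x ∈ Ioo a b, 0 < φ' x) :
    StrictMonoOn φ (Icc a b) := by
  refine strictMonoOn_of_hasDerivWithinAt_pos (convex_Icc a b) hc (f' := φ') ?_ ?_ <;>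
    rw [interior_Icc]
  exacts [fun x hx => (hd x hx).hasDerivWithinAt, hpos]

/-- `k` is the inverse of a function `φ` with derivative `φ'` on `[a, b]`, extended from
`[φ a, φ b]` to the whole line by the constants `a` and `b`. -/
structure ClampedInverse (φ φ' : ℝ → ℝ) (a b : ℝ) (k : ℝ → ℝ) : Prop where
  cont : Continuous k
  mem : ∀ y, k y ∈ Icc a b
  left_inv : ∀ x ∈ Icc a b, k (φ x) = x
  right_inv : ∀ y ∈ Icc (φ a) (φ b), φ (k y) = y
  mem_Ioo : ∀ y ∈ Ioo (φ a) (φ b), k y ∈ Ioo a b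
  of_le : ∀ y ≤ φ a, k y = a
  of_ge : ∀ y, φ b ≤ y → k y = b
  deriv : ∀ y ∈ Ioo (φ a) (φ b), HasDerivAt k (φ' (k y))⁻¹ y

theorem exists_inverse_of_strictMonoOn {φ : ℝ → ℝ} {a b : ℝ} (hab : a ≤ b)
    (hc : ContinuousOn φ (Icc a b)) (hm : StrictMonoOn φ (Icc a b)) :
    ∃ k : ℝ → ℝ, Continuous k ∧ (∀ y, k y ∈ Icc a b) ∧
      (∀ x ∈ Icc a b, k (φ x) = x) ∧ (∀ y ∈ Icc (φ a) (φ b), φ (k y) = y) ∧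
      (∀ y ≤ φ a, k y = a) ∧ ∀ y, φ b ≤ y → k y = b := by
  have ha : a ∈ Icc a b := left_mem_Icc.2 hab
  have hb : b ∈ Icc a b := right_mem_Icc.2 hab
  have hmaps : MapsTo φ (Icc a b) (Icc (φ a) (φ b)) := fun x hx =>
    ⟨hm.monotoneOn ha hx hx.1, hm.monotoneOn hx hb hx.2⟩
  have hfab : φ a ≤ φ b := hm.monotoneOn ha hb hab
  let o : Icc a b ≃o Icc (φ a) (φ b) :=
    StrictMono.orderIsoOfSurjective (hmaps.restrict φ _ _) (fun x y h => hm x.2 y.2 h) fun y => by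
      obtain ⟨x, hx, hxy⟩ := intermediate_value_Icc hab hc y.2
      exact ⟨⟨x, hx⟩, Subtype.ext hxy⟩
  have hleft : ∀ x (hx : x ∈ Icc a b), o.symm (projIcc _ _ hfab (φ x)) = ⟨x, hx⟩ := fun x hx => by
    rw [projIcc_of_mem hfab (hmaps hx)]
    exact o.symm_apply_apply ⟨x, hx⟩
  refine ⟨fun y => o.symm (projIcc _ _ hfab y), ?_, fun y => (o.symm _).2,
    fun x hx => congrArg Subtype.val (hleft x hx), fun y hy => ?_, fun y hy => ?_, fun y hy => ?_⟩
  · exact continuous_subtype_val.comp (o.symm.continuous.comp continuous_projIcc)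
  · simp only [projIcc_of_mem hfab hy]
    exact congrArg Subtype.val (o.apply_symm_apply ⟨y, hy⟩)
  · simp only [projIcc_of_le_left hfab hy, ← projIcc_left hfab, hleft a ha]
  · simp only [projIcc_of_right_le hfab hy, ← projIcc_right hfab, hleft b hb]

theorem exists_clampedInverse {φ φ' : ℝ → ℝ} {a b : ℝ} (hab : a ≤ b)
    (hc : ContinuousOn φ (Icc a b)) (hd : ∀ x ∈ Ioo a b, HasDerivAt φ (φ' x) x)
    (hpos : ∀ x ∈ Ioo a b, 0 < φ' x) : ∃ k, ClampedInverse φ φ' a b k := by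
  obtain ⟨k, hkc, hmem, hleft, hright, hle, hge⟩ :=
    exists_inverse_of_strictMonoOn hab hc (strictMonoOn_Icc_of_deriv_pos hc hd hpos)
  have hmem_Ioo : ∀ y ∈ Ioo (φ a) (φ b), k y ∈ Ioo a b := fun y hy => by
    have hy' := hright y (Ioo_subset_Icc_self hy)
    exact ⟨(hmem y).1.lt_of_ne fun h => hy.1.ne (by rw [h, hy']),
      (hmem y).2.lt_of_ne fun h => hy.2.ne (by rw [← h, hy'])⟩
  refine ⟨k, hkc, hmem, hleft, hright, hmem_Ioo, hle, hge, fun y hy => ?_⟩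
  refine (hd _ (hmem_Ioo y hy)).of_local_left_inverse hkc.continuousAt
    (hpos _ (hmem_Ioo y hy)).ne' ?_
  filter_upwards [Ioo_mem_nhds hy.1 hy.2] with x hx using hright x (Ioo_subset_Icc_self hx)

section Interval

variable {E : Type*} [NormedAddCommGroup E] [NormedSpace ℝ E]

theorem hasDerivWithinAt_Ici_of_Icc {f : ℝ → E} {f' : E} {a b x : ℝ} (hx : x ∈ Ico a b)
    (h : HasDerivWithinAt f f' (Icc a b) x) : HasDerivWithinAt f f' (Ici x) x :=
  h.mono_of_mem_nhdsWithin (mem_of_superset (Icc_mem_nhdsGE hx.2) (Icc_subset_Icc_left hx.1))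

theorem hasDerivWithinAt_Icc_of_Ioo {f φ : ℝ → E} {a b : ℝ} (hab : a < b)
    (hf : ContinuousOn f (Icc a b)) (hφ : ContinuousOn φ (Icc a b))
    (hd : ∀ x ∈ Ioo a b, HasDerivAt f (φ x) x) {x : ℝ} (hx : x ∈ Icc a b) :
    HasDerivWithinAt f (φ x) (Icc a b) x := by
  have hdiff : DifferentiableOn ℝ f (Ioo a b) :=
    fun y hy => (hd y hy).differentiableAt.differentiableWithinAt
  have hderiv : ∀ {y}, y ∈ Icc a b → Tendsto (deriv f) (𝓝[Ioo a b] y) (𝓝 (φ y)) := fun {y} hy =>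
    ((hφ y hy).mono Ioo_subset_Icc_self).congr'
      (eventually_nhdsWithin_of_forall fun z hz => (hd z hz).deriv.symm)
  rcases hx.1.eq_or_lt with rfl | hax
  · refine (hasDerivWithinAt_Ici_of_tendsto_deriv hdiff ((hf a hx).mono Ioo_subset_Icc_self)
      (Ioo_mem_nhdsGT hab) ?_).mono Icc_subset_Ici_self
    rw [← nhdsWithin_Ioo_eq_nhdsGT hab]
    exact hderiv hx
  rcases hx.2.eq_or_lt with rfl | hxb
  · refine (hasDerivWithinAt_Iic_of_tendsto_deriv hdiff ((hf x hx).mono Ioo_subset_Icc_self)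
      (Ioo_mem_nhdsLT hab) ?_).mono Icc_subset_Iic_self
    rw [← nhdsWithin_Ioo_eq_nhdsLT hab]
    exact hderiv hx
  · exact (hd x ⟨hax, hxb⟩).hasDerivWithinAt

theorem hasDerivWithinAt_of_tendsto_of_bounded [CompleteSpace E] {u u' : ℕ → ℝ → E} {V V' : ℝ → E}
    {a b B : ℝ} (hab : a < b)
    (hu : ∀ n, ∀ t ∈ Icc a b, HasDerivWithinAt (u n) (u' n t) (Icc a b) t)
    (hu' : ∀ n, ContinuousOn (u' n) (Icc a b)) (hB : ∀ n, ∀ t ∈ Icc a b, ‖u' n t‖ ≤ B)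
    (hV : ∀ t ∈ Icc a b, Tendsto (u · t) atTop (𝓝 (V t)))
    (hV' : ∀ t ∈ Icc a b, Tendsto (u' · t) atTop (𝓝 (V' t))) (hV'c : ContinuousOn V' (Icc a b))
    {t : ℝ} (ht : t ∈ Icc a b) : HasDerivWithinAt V (V' t) (Icc a b) t := by
  have hint : ∀ n, ∀ s ∈ Icc a b, ∫ x in a..s, u' n x = u n s - u n a := fun n s hs =>
    intervalIntegral.integral_eq_sub_of_hasDerivAt_of_le hs.1
      ((HasDerivWithinAt.continuousOn (hu n)).mono (Icc_subset_Icc_right hs.2))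
      (fun x hx => (hu n x ⟨hx.1.le, hx.2.le.trans hs.2⟩).hasDerivAt
        (Icc_mem_nhds hx.1 (hx.2.trans_le hs.2)))
      (((hu' n).mono (Icc_subset_Icc_right hs.2)).intervalIntegrable_of_Icc hs.1)
  have hVint : ∀ s ∈ Icc a b, V s = V a + ∫ x in a..s, V' x := by
    intro s hs
    have hsub : uIoc a s ⊆ Icc a b := by
      rw [uIoc_of_le hs.1]
      exact Ioc_subset_Icc_self.trans (Icc_subset_Icc_right hs.2)
    have hlim : Tendsto (fun n => ∫ x in a..s, u' n x) atTop (𝓝 (∫ x in a..s, V' x)) :=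
      intervalIntegral.tendsto_integral_filter_of_dominated_convergence (fun _ => B)
        (.of_forall fun n => ((hu' n).mono hsub).aestronglyMeasurable measurableSet_uIoc)
        (.of_forall fun n => .of_forall fun x hx => hB n x (hsub hx)) intervalIntegrable_const
        (.of_forall fun x hx => hV' x (hsub hx))
    have hdiff := (hV s hs).sub (hV a (left_mem_Icc.2 hab.le))
    exact eq_add_of_sub_eq' (tendsto_nhds_unique hdiff (hlim.congr fun n => hint n s hs))
  have hder : HasDerivWithinAt (fun s => V a + ∫ x in a..s, V' x) (V' t) (Icc a b) t :=
    ODE.hasDerivWithinAt_picard_Icc (f := fun s _ => V' s) (α := 0) (u := univ)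
      (left_mem_Icc.2 hab.le) (hV'c.comp continuousOn_fst fun p hp => hp.1) continuousOn_const
      (fun _ _ => mem_univ _) (V a) ht
  exact hder.congr hVint (hVint t ht)

theorem continuousOn_of_tendsto_of_bounded_deriv {u u' : ℕ → ℝ → E} {V : ℝ → E} {a b B : ℝ}
    (hu : ∀ n, ∀ t ∈ Icc a b, HasDerivWithinAt (u n) (u' n t) (Icc a b) t)
    (hB : ∀ n, ∀ t ∈ Icc a b, ‖u' n t‖ ≤ B)
    (hV : ∀ t ∈ Icc a b, Tendsto (u · t) atTop (𝓝 (V t))) : ContinuousOn V (Icc a b) := by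
  refine (LipschitzOnWith.of_dist_le_mul (K := B.toNNReal) fun x hx y hy => ?_).continuousOn
  refine le_of_tendsto ((hV x hx).dist (hV y hy)) (.of_forall fun n => ?_)
  rw [dist_eq_norm, dist_eq_norm]
  exact Convex.norm_image_sub_le_of_norm_hasDerivWithin_le (hu n)
    (fun t ht => (hB n t ht).trans (Real.le_coe_toNNReal B)) (convex_Icc a b) hy hx

end Interval

theorem nonpos_of_deriv_neg_at_zeros {f f' : ℝ → ℝ} {a b : ℝ}
    (hf : ContinuousOn f (Icc a b)) (hd : ∀ x ∈ Ico a b, HasDerivWithinAt f (f' x) (Ici x) x)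
    (ha : f a ≤ 0) (h0 : ∀ x ∈ Ico a b, f x = 0 → f' x < 0) : ∀ x ∈ Icc a b, f x ≤ 0 :=
  fun _ hx => image_le_of_deriv_right_lt_deriv_boundary' (B := fun _ => 0) (B' := fun _ => 0)
    hf hd ha continuousOn_const (fun _ _ => hasDerivWithinAt_const _ _ _) h0 hx

theorem neg_of_deriv_neg_at_zeros {f f' : ℝ → ℝ} {a b : ℝ} (hf : ContinuousOn f (Icc a b))
    (hd : ∀ x ∈ Ico a b, HasDerivWithinAt f (f' x) (Ici x) x)
    (hd' : ∀ x ∈ Ioo a b, HasDerivAt f (f' x) x) (ha : f a ≤ 0)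
    (h0 : ∀ x ∈ Ico a b, f x = 0 → f' x < 0) : ∀ x ∈ Ioo a b, f x < 0 := by
  have hle := nonpos_of_deriv_neg_at_zeros hf hd ha h0
  refine fun x hx => (hle x (Ioo_subset_Icc_self hx)).lt_of_ne fun hfx => ?_
  have hmax : IsLocalMax f x := by
    filter_upwards [Ioo_mem_nhds hx.1 hx.2] with y hy
    exact (hle y (Ioo_subset_Icc_self hy)).trans hfx.ge
  exact (h0 x (Ioo_subset_Ico_self hx) hfx).ne (hmax.hasDerivAt_eq_zero (hd' x hx))

theorem exists_sign_change_of_deriv_neg_at_zeros {f f' : ℝ → ℝ} {a b : ℝ} (hab : a ≤ b)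
    (hf : ContinuousOn f (Icc a b)) (hd : ∀ x ∈ Ioo a b, HasDerivAt f (f' x) x)
    (ha : 0 < f a) (hb : f b < 0) (h0 : ∀ x ∈ Ioo a b, f x = 0 → f' x < 0) :
    ∃ m ∈ Ioo a b, f m = 0 ∧ (∀ x ∈ Ico a m, 0 < f x) ∧ (∀ x ∈ Ioc m b, f x < 0) := by
  obtain ⟨m, hm, hm0⟩ := intermediate_value_Icc' hab hf ⟨hb.le, ha.le⟩
  have hma : a < m := hm.1.lt_of_ne (by rintro rfl; exact ha.ne' hm0)
  have hmb : m < b := hm.2.lt_of_ne (by rintro rfl; exact hb.ne hm0)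
  have hafter : ∀ s ∈ Ioo a b, f s ≤ 0 → ∀ x ∈ Ioo s b, f x < 0 := fun s hs =>
    have hsub : ∀ x ∈ Ico s b, x ∈ Ioo a b := fun x hx => ⟨hs.1.trans_le hx.1, hx.2⟩
    fun hfs => neg_of_deriv_neg_at_zeros (hf.mono (Icc_subset_Icc_left hs.1.le))
      (fun x hx => (hd x (hsub x hx)).hasDerivWithinAt)
      (fun x hx => hd x (hsub x (Ioo_subset_Ico_self hx))) hfs fun x hx => h0 x (hsub x hx)
  refine ⟨m, ⟨hma, hmb⟩, hm0, fun x hx => ?_, fun x hx => ?_⟩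
  · by_contra! hneg
    have hax : a < x := hx.1.lt_of_ne (by rintro rfl; exact hneg.not_gt ha)
    exact (hafter x ⟨hax, hx.2.trans hmb⟩ hneg m ⟨hx.2, hmb⟩).ne hm0
  · rcases hx.2.eq_or_lt with rfl | hxb
    · exact hb
    · exact hafter m ⟨hma, hmb⟩ hm0.le x ⟨hx.1, hxb⟩

/-- A strictly increasing sequence of uniformly bounded Lipschitz functions that converges to `Ψ`
uniformly from strictly below. Solutions of the approximate differential equations increase to the
minimal solution of the equation with right-hand side `Ψ`. -/
structure IsLipschitzApprox (Ψ : ℝ → ℝ) (φ : ℕ → ℝ → ℝ) : Prop where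
  lipschitz : ∀ n, ∃ K, LipschitzWith K (φ n)
  bounded : ∃ B : NNReal, ∀ n x, |φ n x| ≤ B
  lt_succ : ∀ n x, φ n x < φ (n + 1) x
  lt_limit : ∀ n x, φ n x < Ψ x
  tendsto : TendstoUniformly φ Ψ atTop

theorem exists_lipschitzWith_polynomial_eval_projIcc (p : Polynomial ℝ) {l r : ℝ} (hlr : l ≤ r) :
    ∃ K, LipschitzWith K fun x => p.eval (projIcc l r hlr x : ℝ) := by
  have hp : ContDiff ℝ 1 fun x => p.eval x := by
    simpa only [Polynomial.coe_aeval_eq_eval] using p.contDiff_aeval (𝕜 := ℝ) 1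
  obtain ⟨K, hK⟩ := hp.contDiffOn.exists_lipschitzOnWith one_ne_zero (convex_Icc l r) isCompact_Icc
  exact ⟨K * 1, (lipschitzOnWith_iff_restrict.1 hK).comp (LipschitzWith.projIcc hlr)⟩

theorem exists_isLipschitzApprox {Ψ : ℝ → ℝ} {l r : ℝ} (hlr : l ≤ r) (hΨ : Continuous Ψ)
    (hproj : ∀ x, Ψ (projIcc l r hlr x) = Ψ x) : ∃ φ, IsLipschitzApprox Ψ φ := by
  -- Weierstrass approximation with error `4⁻ⁿ` of `Ψ - 3 * 4⁻ⁿ`: the shift beats the errors.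
  have hweier : ∀ n : ℕ, ∃ p : Polynomial ℝ, ∀ x ∈ Icc l r,
      |p.eval x - (Ψ x - 3 * (1 / 4) ^ n)| < (1 / 4) ^ n := fun n =>
    exists_polynomial_near_of_continuousOn l r _ (by fun_prop) _ (by positivity)
  choose p hp using hweier
  have happrox : ∀ n x,
      |(p n).eval (projIcc l r hlr x : ℝ) - (Ψ x - 3 * (1 / 4) ^ n)| < (1 / 4) ^ n :=
    fun n x => by simpa only [hproj] using hp n _ (projIcc l r hlr x).2
  have hpos : ∀ n : ℕ, (0 : ℝ) < (1 / 4) ^ n := fun n => by positivity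
  have herror : ∀ n x, |(p n).eval (projIcc l r hlr x : ℝ) - Ψ x| ≤ 4 * (1 / 4) ^ n := fun n x => by
    have := abs_lt.1 (happrox n x)
    exact abs_le.2 ⟨by linarith, by linarith [hpos n]⟩
  refine ⟨fun n x => (p n).eval (projIcc l r hlr x : ℝ), fun n =>
    exists_lipschitzWith_polynomial_eval_projIcc (p n) hlr, ?_, fun n x => ?_, fun n x => ?_, ?_⟩
  · obtain ⟨B, hB⟩ := isCompact_Icc.exists_bound_of_continuousOn (hΨ.continuousOn (s := Icc l r))
    refine ⟨(B + 4).toNNReal, fun n x => le_trans ?_ (Real.le_coe_toNNReal _)⟩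
    have hΨB : |Ψ x| ≤ B := by simpa only [hproj, Real.norm_eq_abs] using hB _ (projIcc l r hlr x).2
    have hpow : ((1 : ℝ) / 4) ^ n ≤ 1 := pow_le_one₀ (by norm_num) (by norm_num)
    have := abs_sub_abs_le_abs_sub ((p n).eval (projIcc l r hlr x : ℝ)) (Ψ x)
    linarith [herror n x]
  · have h1 := abs_lt.1 (happrox n x)
    have h2 := abs_lt.1 (happrox (n + 1) x)
    rw [pow_succ] at h2
    linarith [h1.2, h2.1, hpos n]
  · linarith [(abs_lt.1 (happrox n x)).2, hpos n]
  · have hlim : Tendsto (fun n : ℕ => 4 * ((1 : ℝ) / 4) ^ n) atTop (𝓝 0) := by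
      simpa using (tendsto_pow_atTop_nhds_zero_of_lt_one (r := (1 : ℝ) / 4) (by norm_num)
        (by norm_num)).const_mul 4
    refine Metric.tendstoUniformly_iff.2 fun ε hε => ?_
    filter_upwards [hlim.eventually (gt_mem_nhds hε)] with n hn x
    rw [dist_comm, Real.dist_eq]
    exact (herror n x).trans_lt hn

theorem exists_solution_of_lipschitz_of_bounded {φ h : ℝ → ℝ} {K L : NNReal}
    (hφ : LipschitzWith K φ) (hL : ∀ x, |φ x| ≤ L) {a b : ℝ} (hab : a ≤ b)
    (hh : ContinuousOn h (Icc a b)) (k : ℝ) :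
    ∃ u : ℝ → ℝ, u a = k ∧ ∀ t ∈ Icc a b, HasDerivWithinAt u (φ (u t - h t)) (Icc a b) t := by
  have hpl : IsPicardLindelof (fun t x => φ (x - h t)) (⟨a, left_mem_Icc.2 hab⟩ : Icc a b) k
      (L * (b - a).toNNReal) 0 L K :=
    { lipschitzOnWith := fun t _ x _ y _ => by
        simpa only [edist_sub_right] using hφ (x - h t) (y - h t)
      continuousOn := fun x _ => hφ.continuous.comp_continuousOn (continuousOn_const.sub hh)
      norm_le := fun t _ x _ => hL _
      mul_max_le := by simp [Real.coe_toNNReal _ (sub_nonneg.2 hab), hab] }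
  exact hpl.exists_eq_forall_mem_Icc_hasDerivWithinAt₀

/-- `u` solves `u' = v(t, u)` on `[a, b]` with `u(a) = k`, and it lies below every solution that
starts at or above `k`. The competitors `w` need only have right derivatives, so that they can be
glued from pieces. -/
structure IsMinimalSolution (v : ℝ → ℝ → ℝ) (a b k : ℝ) (u : ℝ → ℝ) : Prop where
  initial : u a = k
  deriv : ∀ t ∈ Icc a b, HasDerivWithinAt u (v t (u t)) (Icc a b) t
  le_solution : ∀ w, k ≤ w a → ContinuousOn w (Icc a b) →
    (∀ t ∈ Ico a b, HasDerivWithinAt w (v t (w t)) (Ici t) t) → ∀ t ∈ Icc a b, u t ≤ w t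

theorem IsLipschitzApprox.exists_isMinimalSolution {Ψ h : ℝ → ℝ} {φ : ℕ → ℝ → ℝ}
    (hφ : IsLipschitzApprox Ψ φ) {a b : ℝ} (hab : a < b) (hh : ContinuousOn h (Icc a b)) (k : ℝ) :
    ∃ u, IsMinimalSolution (fun t x => Ψ (x - h t)) a b k u := by
  have hlip := hφ.lipschitz
  obtain ⟨B, hB⟩ := hφ.bounded
  choose K hK using hlip
  have hΨ : Continuous Ψ := hφ.tendsto.continuous (.of_forall fun n => (hK n).continuous)
  choose u hu0 hu using fun n => exists_solution_of_lipschitz_of_bounded (hK n) (hB n) hab.le hh k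
  have hucont : ∀ n, ContinuousOn (u n) (Icc a b) := fun n => HasDerivWithinAt.continuousOn (hu n)
  have huIci : ∀ n, ∀ t ∈ Ico a b, HasDerivWithinAt (u n) (φ n (u n t - h t)) (Ici t) t :=
    fun n t ht => hasDerivWithinAt_Ici_of_Icc ht (hu n t (Ico_subset_Icc_self ht))
  have hle : ∀ n w, k ≤ w a → ContinuousOn w (Icc a b) →
      (∀ t ∈ Ico a b, HasDerivWithinAt w (Ψ (w t - h t)) (Ici t) t) →
      ∀ t ∈ Icc a b, u n t ≤ w t := fun n w hw hwc hwd t ht =>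
    image_le_of_deriv_right_lt_deriv_boundary' (hucont n) (huIci n) ((hu0 n).trans_le hw) hwc hwd
      (fun s _ hs => hs ▸ hφ.lt_limit n _) ht
  have hmono : ∀ t ∈ Icc a b, Monotone fun n => u n t := fun t ht =>
    monotone_nat_of_le_succ fun n => image_le_of_deriv_right_lt_deriv_boundary' (hucont n) (huIci n)
      ((hu0 n).trans (hu0 (n + 1)).symm).le (hucont (n + 1)) (huIci (n + 1))
      (fun s _ hs => hs ▸ hφ.lt_succ n _) ht
  have hbdd : ∀ t ∈ Icc a b, BddAbove (range fun n => u n t) := by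
    refine fun t ht => ⟨k + B * (t - a), ?_⟩
    rintro _ ⟨n, rfl⟩
    have := norm_image_sub_le_of_norm_deriv_le_segment' (hu n) (fun s _ => hB n _) t ht
    linarith [le_abs_self (u n t - u n a), Real.norm_eq_abs (u n t - u n a), hu0 n]
  set V : ℝ → ℝ := fun t => ⨆ n, u n t
  have hV : ∀ t ∈ Icc a b, Tendsto (u · t) atTop (𝓝 (V t)) := fun t ht =>
    tendsto_atTop_ciSup (hmono t ht) (hbdd t ht)
  have hVcont : ContinuousOn V (Icc a b) :=
    continuousOn_of_tendsto_of_bounded_deriv hu (fun n t _ => hB n _) hV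
  refine ⟨V, by simp only [V, hu0, ciSup_const], fun t ht => ?_, fun w hw hwc hwd t ht =>
    ciSup_le fun n => hle n w hw hwc hwd t ht⟩
  exact hasDerivWithinAt_of_tendsto_of_bounded hab hu
    (fun n => (hK n).continuous.comp_continuousOn ((hucont n).sub hh)) (fun n t _ => hB n _) hV
    (fun t ht => hφ.tendsto.tendsto_comp hΨ.continuousAt ((hV t ht).sub_const _))
    (hΨ.comp_continuousOn (hVcont.sub hh)) ht

theorem exists_isFixedPt_of_monotoneOn_Icc {α : Type*} [ConditionallyCompleteLattice α] {P : α → α}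
    {c K : α} (hcK : c ≤ K) (hP : MonotoneOn P (Icc c K)) (hmaps : MapsTo P (Icc c K) (Icc c K)) :
    ∃ k ∈ Icc c K, Function.IsFixedPt P k :=
  have : Fact (c ≤ K) := ⟨hcK⟩
  let F : Icc c K →o Icc c K := ⟨hmaps.restrict P _ _, fun x y h => hP x.2 y.2 h⟩
  ⟨F.lfp, F.lfp.2, congrArg Subtype.val F.map_lfp⟩

theorem le_of_deriv_nonneg_below {u u' : ℝ → ℝ} {a b c : ℝ} (hu : ContinuousOn u (Icc a b))
    (hd : ∀ t ∈ Ico a b, HasDerivWithinAt u (u' t) (Ici t) t) (ha : c ≤ u a)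
    (h : ∀ t ∈ Ico a b, u t ≤ c → 0 ≤ u' t) : ∀ t ∈ Icc a b, c ≤ u t := by
  intro t ht
  have hline : ∀ ε > 0, c - ε * (t - a) ≤ u t := fun ε hε =>
    image_le_of_deriv_right_lt_deriv_boundary' (f := fun s => c - ε * (s - a)) (f' := fun _ => -ε)
      (by fun_prop)
      (fun s _ => by
        simpa using ((((hasDerivAt_id s).sub_const a).const_mul ε).const_sub c).hasDerivWithinAt)
      (by simpa using ha) hu hd
      (fun s hs hus => (neg_lt_zero.2 hε).trans_le <| h s hs <| by
        nlinarith [mul_nonneg hε.le (sub_nonneg.2 hs.1)]) ht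
  have hlim : Tendsto (fun ε => c - ε * (t - a)) (𝓝[>] 0) (𝓝 c) := by
    have : Continuous fun ε : ℝ => c - ε * (t - a) := by fun_prop
    simpa using (this.tendsto 0).mono_left nhdsWithin_le_nhds
  exact le_of_tendsto hlim (eventually_nhdsWithin_of_forall hline)

theorem hasDerivAt_sq_div_two (s : ℝ) : HasDerivAt (fun s : ℝ => s ^ 2 / 2) s s := by
  simpa using (hasDerivAt_pow 2 s).div_const 2

/-- A solution `z` of `z' = Ψ z - s` on `[p, q]` with `p < 0 < q` that is positive inside and
vanishes at both ends. In the coordinates `z = G(x)`, `s = -y` it is the half `x ≥ 0` of an orbit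
of the Liénard system, with `Ψ(G(x)) = -F(x)`. -/
structure Arc (Ψ : ℝ → ℝ) (p q : ℝ) (z : ℝ → ℝ) : Prop where
  neg : p < 0
  pos : 0 < q
  cont : ContinuousOn z (Icc p q)
  left : z p = 0
  right : z q = 0
  posIoo : ∀ s ∈ Ioo p q, 0 < z s
  deriv : ∀ s ∈ Ioo p q, HasDerivAt z (Ψ (z s) - s) s

namespace Arc

variable {Ψ : ℝ → ℝ} {p q : ℝ} {z : ℝ → ℝ}

theorem lt (A : Arc Ψ p q z) : p < q := A.neg.trans A.pos

theorem nonneg (A : Arc Ψ p q z) {s : ℝ} (hs : s ∈ Icc p q) : 0 ≤ z s := by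
  rcases hs.1.eq_or_lt with rfl | hps
  · exact A.left.ge
  rcases hs.2.eq_or_lt with rfl | hsq
  · exact A.right.ge
  exact (A.posIoo s ⟨hps, hsq⟩).le

theorem reflect (A : Arc Ψ p q z) : Arc (fun x => -Ψ x) (-q) (-p) fun s => z (-s) where
  neg := neg_lt_zero.2 A.pos
  pos := neg_pos.2 A.neg
  cont := A.cont.comp continuousOn_neg fun s hs => ⟨le_neg.2 hs.2, neg_le.2 hs.1⟩
  left := by rw [neg_neg, A.right]
  right := by rw [neg_neg, A.left]
  posIoo s hs := A.posIoo _ ⟨lt_neg.2 hs.2, neg_lt.2 hs.1⟩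
  deriv s hs :=
    ((A.deriv (-s) ⟨lt_neg.2 hs.2, neg_lt.2 hs.1⟩).comp s (hasDerivAt_neg s)).congr_deriv (by ring)

end Arc

section Existence

variable {Ψ : ℝ → ℝ} {M k : ℝ} {u : ℝ → ℝ}

-- At a zero of `z = u - s² / 2` one has `z' = -s > 0`, so `z` changes sign once on `[-M, 0]`;
-- before that `u' = Ψ z = 0` and `u` keeps its initial value.
theorem exists_entry_of_solution (h0 : ∀ x ≤ 0, Ψ x = 0) (hM : 0 < M) (hkM : k ≤ M ^ 2 / 2)
    (hu : ∀ s ∈ Icc (-M) M, HasDerivWithinAt u (Ψ (u s - s ^ 2 / 2)) (Icc (-M) M) s)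
    (huM : u (-M) = k) (hu0 : 0 < u 0) :
    ∃ m ∈ Ico (-M) 0, m ^ 2 / 2 = k ∧ u m = k ∧ ∀ s ∈ Ioc m 0, 0 < u s - s ^ 2 / 2 := by
  have hucont : ContinuousOn u (Icc (-M) M) := HasDerivWithinAt.continuousOn hu
  have hcont : ContinuousOn (fun s => s ^ 2 / 2 - u s) (Icc (-M) 0) :=
    (Continuous.continuousOn (by fun_prop)).sub (hucont.mono (Icc_subset_Icc_right hM.le))
  have hderiv : ∀ s ∈ Ioo (-M) M,
      HasDerivAt (fun s => s ^ 2 / 2 - u s) (s - Ψ (u s - s ^ 2 / 2)) s := fun s hs =>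
    (hasDerivAt_sq_div_two s).sub
      ((hu s (Ioo_subset_Icc_self hs)).hasDerivAt (Icc_mem_nhds hs.1 hs.2))
  have hneg : ∀ s < 0, s ^ 2 / 2 - u s = 0 → s - Ψ (u s - s ^ 2 / 2) < 0 := fun s hs hzs => by
    rw [h0 _ (by linarith)]
    linarith
  rcases hkM.eq_or_lt with rfl | hkM
  · refine ⟨-M, ⟨le_rfl, by linarith⟩, by rw [neg_sq], huM, fun s hs => ?_⟩
    rcases hs.2.eq_or_lt with rfl | hs0
    · simpa using hu0
    have := neg_of_deriv_neg_at_zeros hcont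
      (fun s hs => (hasDerivWithinAt_Ici_of_Icc ⟨hs.1, hs.2.trans hM⟩
        ((hasDerivAt_sq_div_two s).hasDerivWithinAt.sub (hu s ⟨hs.1, (hs.2.trans hM).le⟩))))
      (fun s hs => hderiv s ⟨hs.1, hs.2.trans hM⟩) (by rw [huM, neg_sq, sub_self])
      (fun s hs => hneg s hs.2) s ⟨hs.1, hs0⟩
    linarith
  · obtain ⟨m, hm, hm0, hbefore, hafter⟩ := exists_sign_change_of_deriv_neg_at_zeros
      (by linarith) hcont (fun s hs => hderiv s ⟨hs.1, hs.2.trans hM⟩)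
      (by rw [huM, neg_sq]; linarith) (by simpa using hu0) (fun s hs => hneg s hs.2)
    have hum : u m = k := by
      rw [← huM]
      refine constant_of_has_deriv_right_zero
        (hucont.mono (Icc_subset_Icc_right (hm.2.trans hM).le)) (fun s hs => ?_) m ⟨hm.1.le, le_rfl⟩
      have hsM : s < M := (hs.2.trans hm.2).trans hM
      have := hasDerivWithinAt_Ici_of_Icc ⟨hs.1, hsM⟩ (hu s ⟨hs.1, hsM.le⟩)
      rwa [h0 _ (by linarith [hbefore s hs])] at this
    exact ⟨m, ⟨hm.1.le, hm.2⟩, by linarith, hum, fun s hs => by linarith [hafter s hs]⟩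

theorem exists_symmetric_arc_of_solution (h0 : ∀ x ≤ 0, Ψ x = 0) (hM : 0 < M)
    (hkM : k ≤ M ^ 2 / 2)
    (hu : ∀ s ∈ Icc (-M) M, HasDerivWithinAt u (Ψ (u s - s ^ 2 / 2)) (Icc (-M) M) s)
    (huM : u (-M) = k) (huM' : u M = k) (hu0 : 0 < u 0) :
    ∃ Y ≤ M, Arc Ψ (-Y) Y fun s => u s - s ^ 2 / 2 := by
  have hu' : ∀ s ∈ Icc (-M) M, HasDerivWithinAt (fun s => u (-s))
      (-Ψ (u (-s) - s ^ 2 / 2)) (Icc (-M) M) s := fun s hs => by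
    refine ((hu (-s) ⟨neg_le_neg hs.2, neg_le.2 hs.1⟩).comp s (hasDerivAt_neg s).hasDerivWithinAt
      fun t (ht : t ∈ Icc (-M) M) => ⟨neg_le_neg ht.2, neg_le.2 ht.1⟩).congr_deriv ?_
    rw [neg_sq, mul_neg_one]
  obtain ⟨m, hm, hmk, hum, hpos⟩ := exists_entry_of_solution h0 hM hkM hu huM hu0
  obtain ⟨n, hn, hnk, hun, hpos'⟩ := exists_entry_of_solution (Ψ := fun x => -Ψ x)
    (fun x hx => by rw [h0 x hx, neg_zero]) hM hkM hu' (by rwa [neg_neg])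
    (by rwa [neg_zero])
  obtain rfl : n = m := by nlinarith [hm.2, hn.2]
  refine ⟨-n, by linarith [hm.1], ?_⟩
  rw [neg_neg]
  refine ⟨hm.2, by linarith [hm.2], ?_, by linarith, by rw [neg_sq]; linarith, fun s hs => ?_,
    fun s hs => ?_⟩
  · exact ((HasDerivWithinAt.continuousOn hu).mono
      (Icc_subset_Icc hm.1 (by linarith [hm.1]))).sub (Continuous.continuousOn (by fun_prop))
  · rcases le_total s 0 with hs0 | hs0
    · exact hpos s ⟨hs.1, hs0⟩
    · simpa using hpos' (-s) ⟨lt_neg.1 hs.2, neg_nonpos.2 hs0⟩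
  · have hsM : -M < s ∧ s < M := ⟨hm.1.trans_lt hs.1, by linarith [hs.2, hm.1]⟩
    exact ((hu s ⟨hsM.1.le, hsM.2.le⟩).hasDerivAt (Icc_mem_nhds hsM.1 hsM.2)).sub
      (hasDerivAt_sq_div_two s)

/-- The function `ζ + s² / 2` of an arc `ζ` over `[p, q]`, continued by its final value `q² / 2`. -/
def arcMajorant (ζ : ℝ → ℝ) (q s : ℝ) : ℝ := ζ (min s q) + min s q ^ 2 / 2

variable {p q : ℝ} {ζ : ℝ → ℝ}

theorem Arc.continuousOn_arcMajorant (A : Arc Ψ p q ζ) (b : ℝ) :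
    ContinuousOn (arcMajorant ζ q) (Icc p b) :=
  ContinuousOn.comp (g := fun s => ζ s + s ^ 2 / 2) (t := Icc p q)
    (A.cont.add (Continuous.continuousOn (by fun_prop))) (Continuous.continuousOn (by fun_prop))
    fun _ hs => ⟨le_min hs.1 A.lt.le, min_le_right _ _⟩

theorem Arc.arcMajorant_of_ge (A : Arc Ψ p q ζ) {s : ℝ} (hs : q ≤ s) :
    arcMajorant ζ q s = q ^ 2 / 2 := by
  rw [arcMajorant, min_eq_right hs, A.right, zero_add]

theorem arcMajorant_of_le {s : ℝ} (hs : s ≤ q) : arcMajorant ζ q s = ζ s + s ^ 2 / 2 := by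
  rw [arcMajorant, min_eq_left hs]

theorem Arc.hasDerivWithinAt_arcMajorant (hΨ : Continuous Ψ) (h0 : ∀ x ≤ 0, Ψ x = 0)
    (A : Arc Ψ p q ζ) {s : ℝ} (hs : p ≤ s) :
    HasDerivWithinAt (arcMajorant ζ q) (Ψ (arcMajorant ζ q s - s ^ 2 / 2)) (Ici s) s := by
  rcases lt_or_ge s q with hsq | hqs
  · rw [arcMajorant_of_le hsq.le, add_sub_cancel_right]
    have hd : HasDerivWithinAt (fun s => ζ s + s ^ 2 / 2) (Ψ (ζ s)) (Icc p q) s :=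
      hasDerivWithinAt_Icc_of_Ioo (φ := fun s => Ψ (ζ s)) A.lt
        (A.cont.add (Continuous.continuousOn (by fun_prop)))
        (hΨ.comp_continuousOn A.cont)
        (fun t ht => ((A.deriv t ht).add (hasDerivAt_sq_div_two t)).congr_deriv (by ring))
        ⟨hs, hsq.le⟩
    refine (hasDerivWithinAt_Ici_of_Icc ⟨hs, hsq⟩ hd).congr_of_eventuallyEq ?_
      (arcMajorant_of_le hsq.le)
    filter_upwards [Icc_mem_nhdsGE hsq] with t ht using arcMajorant_of_le ht.2
  · have hz : arcMajorant ζ q s - s ^ 2 / 2 ≤ 0 := by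
      rw [A.arcMajorant_of_ge hqs]
      nlinarith [A.pos]
    rw [h0 _ hz]
    exact (hasDerivWithinAt_const s (Ici s) (q ^ 2 / 2)).congr
      (fun t ht => A.arcMajorant_of_ge (hqs.trans ht)) (A.arcMajorant_of_ge hqs)

-- The Poincaré map `k ↦ U k M` of the minimal solutions is monotone and maps `[c, p² / 2]` into
-- itself, since the constant `c` is a lower solution and the continued arc an upper solution.
theorem Arc.exists_symmetric {φ : ℕ → ℝ → ℝ} (hφ : IsLipschitzApprox Ψ φ) (hΨ : Continuous Ψ)
    (h0 : ∀ x ≤ 0, Ψ x = 0) {r : ℝ} (hr : 0 < r) (hpos : ∀ x ∈ Icc 0 r, 0 ≤ Ψ x)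
    (A : Arc Ψ p q ζ) (hqp : q ≤ -p) {R : ℝ} (hR : ∀ s ∈ Icc p q, ζ s ≤ R) :
    ∃ Y z, Arc Ψ (-Y) Y z ∧ ∀ s ∈ Icc (-Y) Y, z s ≤ R := by
  obtain ⟨M, rfl⟩ : ∃ M, p = -M := ⟨-p, (neg_neg p).symm⟩
  rw [neg_neg] at hqp
  have hM : 0 < M := neg_lt_zero.1 A.neg
  have hright : M ∈ Icc (-M) M := ⟨by linarith, le_rfl⟩
  choose U hU using fun k => hφ.exists_isMinimalSolution (h := fun s => s ^ 2 / 2)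
    (neg_lt_self hM) (Continuous.continuousOn (by fun_prop)) k
  have hUcont : ∀ k, ContinuousOn (U k) (Icc (-M) M) := fun k =>
    HasDerivWithinAt.continuousOn (hU k).deriv
  have hUIci : ∀ k, ∀ s ∈ Ico (-M) M,
      HasDerivWithinAt (U k) (Ψ (U k s - s ^ 2 / 2)) (Ici s) s := fun k s hs =>
    hasDerivWithinAt_Ici_of_Icc hs ((hU k).deriv s (Ico_subset_Icc_self hs))
  set v := arcMajorant ζ q
  have hvM : v (-M) = M ^ 2 / 2 := by
    rw [show v (-M) = _ from arcMajorant_of_le A.lt.le, A.left, zero_add, neg_sq]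
  have hupper : ∀ k ≤ M ^ 2 / 2, ∀ s ∈ Icc (-M) M, U k s ≤ v s := fun k hk =>
    (hU k).le_solution v (hk.trans hvM.ge) (A.continuousOn_arcMajorant M)
      fun s hs => A.hasDerivWithinAt_arcMajorant hΨ h0 hs.1
  obtain ⟨c, hc0, hcr, hcM⟩ : ∃ c, 0 < c ∧ c ≤ r ∧ c ≤ M ^ 2 / 2 :=
    ⟨min r (M ^ 2 / 2), lt_min hr (by positivity), min_le_left _ _, min_le_right _ _⟩
  have hΨr : ∀ x ≤ r, 0 ≤ Ψ x := fun x hx =>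
    (le_total x 0).elim (fun h => (h0 x h).ge) fun h => hpos x ⟨h, hx⟩
  have hlower : ∀ k, c ≤ k → ∀ s ∈ Icc (-M) M, c ≤ U k s := fun k hk =>
    le_of_deriv_nonneg_below (hUcont k) (hUIci k) (hk.trans (hU k).initial.ge)
      fun s _ hs => hΨr _ (by nlinarith)
  obtain ⟨k, hk, hfix⟩ := exists_isFixedPt_of_monotoneOn_Icc (P := fun k => U k M) hcM
    (fun k _ k' _ hkk' => (hU k).le_solution (U k') (hkk'.trans (hU k').initial.ge) (hUcont k')
      (hUIci k') M hright)
    (fun k hk => ⟨hlower k hk.1 M hright, (hupper k hk.2 M hright).trans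
      ((A.arcMajorant_of_ge hqp).trans_le (by nlinarith [A.pos]))⟩)
  obtain ⟨Y, hYM, B⟩ := exists_symmetric_arc_of_solution h0 hM hk.2 (hU k).deriv (hU k).initial
    hfix (hc0.trans_le (hlower k hk.1 0 ⟨by linarith, hM.le⟩))
  refine ⟨Y, _, B, fun s hs => ?_⟩
  have hUv := hupper k hk.2 s ⟨(neg_le_neg hYM).trans hs.1, hs.2.trans hYM⟩
  have hR0 : 0 ≤ R := A.left ▸ hR _ (left_mem_Icc.2 A.lt.le)
  rcases le_total s q with hsq | hqs
  · rw [show v s = _ from arcMajorant_of_le hsq] at hUv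
    linarith [hR s ⟨(neg_le_neg hYM).trans hs.1, hsq⟩]
  · rw [show v s = _ from A.arcMajorant_of_ge hqs] at hUv
    nlinarith [A.pos]

end Existence

/-- A solution `σ` of `dσ/dr = 1 / (Ψ r - σ)` on `[0, R]` that stays below the graph of `Ψ` on
`[0, R)`: the equation of arcs with `s` as a function of `z`, on the part where `z` increases. In
this form solutions are unique even at `r = 0`, where `Ψ` need not be Lipschitz. -/
structure Branch (Ψ : ℝ → ℝ) (R : ℝ) (σ : ℝ → ℝ) : Prop where
  cont : ContinuousOn σ (Icc 0 R)
  lt : ∀ r ∈ Ico 0 R, σ r < Ψ r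
  deriv : ∀ r ∈ Ioo 0 R, HasDerivAt σ (Ψ r - σ r)⁻¹ r

namespace Branch

variable {Ψ : ℝ → ℝ} {R R' r : ℝ} {σ τ : ℝ → ℝ}

theorem mono (b : Branch Ψ R σ) (h : R' ≤ R) : Branch Ψ R' σ where
  cont := b.cont.mono (Icc_subset_Icc_right h)
  lt r hr := b.lt r ⟨hr.1, hr.2.trans_le h⟩
  deriv r hr := b.deriv r ⟨hr.1, hr.2.trans_le h⟩

theorem sub_mul_sub_pos (b : Branch Ψ R σ) (c : Branch Ψ R τ) (hr : r ∈ Ico 0 R) :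
    0 < (Ψ r - σ r) * (Ψ r - τ r) :=
  mul_pos (sub_pos.2 (b.lt r hr)) (sub_pos.2 (c.lt r hr))

theorem hasDerivAt_sub (b : Branch Ψ R σ) (c : Branch Ψ R τ) (hr : r ∈ Ioo 0 R) :
    HasDerivAt (fun x => σ x - τ x) (((Ψ r - σ r) * (Ψ r - τ r))⁻¹ * (σ r - τ r)) r := by
  have hσ := (sub_pos.2 (b.lt r (Ioo_subset_Ico_self hr))).ne'
  have hτ := (sub_pos.2 (c.lt r (Ioo_subset_Ico_self hr))).ne'
  refine ((b.deriv r hr).sub (c.deriv r hr)).congr_deriv ?_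
  field_simp
  ring

theorem hasDerivAt_sq_sub_sq (b : Branch Ψ R σ) (c : Branch Ψ R τ) (hr : r ∈ Ioo 0 R) :
    HasDerivAt (fun x => σ x ^ 2 - τ x ^ 2)
      (Ψ r * (2 * (σ r - τ r) / ((Ψ r - σ r) * (Ψ r - τ r)))) r := by
  have hσ := (sub_pos.2 (b.lt r (Ioo_subset_Ico_self hr))).ne'
  have hτ := (sub_pos.2 (c.lt r (Ioo_subset_Ico_self hr))).ne'
  refine (((b.deriv r hr).pow 2).sub ((c.deriv r hr).pow 2)).congr_deriv ?_
  field_simp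
  ring

theorem eq_zero_of_eq (b : Branch Ψ R σ) (c : Branch Ψ R τ) (hr : r ∈ Icc 0 R) (h : σ r = τ r) :
    σ 0 = τ 0 := by
  have hmono : MonotoneOn (fun x => (σ x - τ x) ^ 2) (Icc 0 R) := by
    refine monotoneOn_of_hasDerivWithinAt_nonneg (convex_Icc 0 R) ((b.cont.sub c.cont).pow 2)
      (fun x hx => ((b.hasDerivAt_sub c (by rwa [interior_Icc] at hx)).pow 2).hasDerivWithinAt)
      fun x hx => ?_
    rw [interior_Icc] at hx
    have := b.sub_mul_sub_pos c (Ioo_subset_Ico_self hx)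
    rw [pow_one, mul_left_comm, mul_assoc, ← sq]
    positivity
  have := hmono ⟨le_rfl, hr.1.trans hr.2⟩ hr hr.1
  nlinarith

theorem eqOn_of_eq_zero (hΨ : Continuous Ψ) (b : Branch Ψ R σ) (c : Branch Ψ R τ)
    (h : σ 0 = τ 0) : EqOn σ τ (Icc 0 R) := by
  rcases le_or_gt R 0 with hR | hR
  · intro x hx
    rwa [le_antisymm (hx.2.trans hR) hx.1]
  suffices hIco : EqOn σ τ (Ico 0 R) from
    hIco.of_subset_closure b.cont c.cont Ico_subset_Icc_self (closure_Ico hR.ne).ge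
  intro x hx
  rcases hx.1.eq_or_lt with rfl | hx0
  · exact h
  have hsub : Icc 0 x ⊆ Ico 0 R := fun y hy => ⟨hy.1, hy.2.trans_lt hx.2⟩
  have hσ := b.cont.mono (hsub.trans Ico_subset_Icc_self)
  have hτ := c.cont.mono (hsub.trans Ico_subset_Icc_self)
  have hκ : ContinuousOn (fun x => ((Ψ x - σ x) * (Ψ x - τ x))⁻¹) (Icc 0 x) :=
    ((hΨ.continuousOn.sub hσ).mul (hΨ.continuousOn.sub hτ)).inv₀ fun y hy =>
      (b.sub_mul_sub_pos c (hsub hy)).ne'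
  obtain ⟨K, hK⟩ := isCompact_Icc.exists_bound_of_continuousOn hκ
  refine sub_eq_zero.1 <| eq_zero_of_abs_deriv_le_mul_abs_self_of_eq_zero_right (K := K)
    (f' := fun y => ((Ψ y - σ y) * (Ψ y - τ y))⁻¹ * (σ y - τ y)) (hσ.sub hτ) (fun y hy => ?_)
    (sub_eq_zero.2 h) (fun y hy => ?_) x (right_mem_Icc.2 hx.1)
  · exact hasDerivWithinAt_Ici_of_Icc hy <| hasDerivWithinAt_Icc_of_Ioo hx0 (hσ.sub hτ)
      (hκ.mul (hσ.sub hτ)) (fun t ht => b.hasDerivAt_sub c ⟨ht.1, ht.2.trans hx.2⟩)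
      (Ico_subset_Icc_self hy)
  · rw [norm_mul]
    exact mul_le_mul_of_nonneg_right (hK y (Ico_subset_Icc_self hy)) (norm_nonneg _)

theorem eqOn_of_eq (hΨ : Continuous Ψ) (b : Branch Ψ R σ) (c : Branch Ψ R τ) (hr : r ∈ Icc 0 R)
    (h : σ r = τ r) : EqOn σ τ (Icc 0 R) :=
  b.eqOn_of_eq_zero hΨ c (b.eq_zero_of_eq c hr h)

theorem lt_of_lt (b : Branch Ψ R σ) (c : Branch Ψ R τ) (h : τ 0 < σ 0) (hr : r ∈ Icc 0 R) :
    τ r < σ r := by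
  by_contra! hge
  obtain ⟨t, ht, ht0⟩ := intermediate_value_Icc' hr.1
    ((b.cont.sub c.cont).mono (Icc_subset_Icc_right hr.2))
    (show (0 : ℝ) ∈ Icc (σ r - τ r) (σ 0 - τ 0) from ⟨by linarith, by linarith⟩)
  exact h.ne' (b.eq_zero_of_eq c ⟨ht.1, ht.2.trans hr.2⟩ (sub_eq_zero.1 ht0))

theorem le_of_eq_of_meets_graph (hΨ : Continuous Ψ) (b : Branch Ψ R σ) (c : Branch Ψ R' τ)
    (hτ : τ R' = Ψ R') (hr : r ∈ Icc 0 R') (h : σ r = τ r) : R ≤ R' := by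
  by_contra! hlt
  have hR' : 0 ≤ R' := hr.1.trans hr.2
  have := (b.mono hlt.le).eqOn_of_eq hΨ c hr h ⟨hR', le_rfl⟩
  exact (b.lt R' ⟨hR', hlt⟩).ne (this.trans hτ)

theorem sq_sub_sq_lt (hR : 0 < R) (b : Branch Ψ R σ) (c : Branch Ψ R τ)
    (hlt : ∀ r ∈ Ioo 0 R, τ r < σ r) (hpos : ∀ r ∈ Ioo 0 R, 0 < Ψ r) :
    σ 0 ^ 2 - τ 0 ^ 2 < σ R ^ 2 - τ R ^ 2 := by
  refine strictMonoOn_Icc_of_deriv_pos ((b.cont.pow 2).sub (c.cont.pow 2))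
    (fun x => b.hasDerivAt_sq_sub_sq c) (fun x hx => ?_)
    (left_mem_Icc.2 hR.le) (right_mem_Icc.2 hR.le) hR
  exact mul_pos (hpos x hx) (div_pos (mul_pos two_pos (sub_pos.2 (hlt x hx)))
    (b.sub_mul_sub_pos c (Ioo_subset_Ico_self hx)))

theorem lt_sq_sub_sq (hR : 0 < R) (b : Branch Ψ R σ) (c : Branch Ψ R τ)
    (hlt : ∀ r ∈ Ioo 0 R, τ r < σ r) (hneg : ∀ r ∈ Ioo 0 R, Ψ r < 0) :
    σ R ^ 2 - τ R ^ 2 < σ 0 ^ 2 - τ 0 ^ 2 := by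
  refine strictAntiOn_of_hasDerivWithinAt_neg (convex_Icc 0 R)
    ((b.cont.pow 2).sub (c.cont.pow 2))
    (fun x hx => (b.hasDerivAt_sq_sub_sq c (by rwa [interior_Icc] at hx)).hasDerivWithinAt)
    (fun x hx => ?_) (left_mem_Icc.2 hR.le) (right_mem_Icc.2 hR.le) hR
  rw [interior_Icc] at hx
  exact mul_neg_of_neg_of_pos (hneg x hx) (div_pos (mul_pos two_pos (sub_pos.2 (hlt x hx)))
    (b.sub_mul_sub_pos c (Ioo_subset_Ico_self hx)))

end Branch

/-- The part of an arc, starting on the axis `z = 0`, over which `z` increases: it ends at the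
vertex `m`, where `Ψ (z m) = m`. -/
structure Rise (Ψ : ℝ → ℝ) (p m : ℝ) (z : ℝ → ℝ) : Prop where
  lt : p < m
  cont : ContinuousOn z (Icc p m)
  left : z p = 0
  below : ∀ s ∈ Ico p m, s < Ψ (z s)
  vertex : Ψ (z m) = m
  deriv : ∀ s ∈ Ioo p m, HasDerivAt z (Ψ (z s) - s) s

namespace Rise

variable {Ψ : ℝ → ℝ} {p m p' m' s : ℝ} {z z' : ℝ → ℝ}

theorem deriv_pos (A : Rise Ψ p m z) (hs : s ∈ Ioo p m) : 0 < Ψ (z s) - s :=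
  sub_pos.2 (A.below s (Ioo_subset_Ico_self hs))

theorem strictMonoOn (A : Rise Ψ p m z) : StrictMonoOn z (Icc p m) :=
  strictMonoOn_Icc_of_deriv_pos A.cont A.deriv fun _ => A.deriv_pos

theorem mem_Icc (A : Rise Ψ p m z) (hs : s ∈ Icc p m) : z s ∈ Icc 0 (z m) :=
  ⟨A.left ▸ A.strictMonoOn.monotoneOn (left_mem_Icc.2 A.lt.le) hs hs.1,
    A.strictMonoOn.monotoneOn hs (right_mem_Icc.2 A.lt.le) hs.2⟩

theorem exists_branch (A : Rise Ψ p m z) :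
    ∃ σ, Branch Ψ (z m) σ ∧ (∀ s ∈ Icc p m, σ (z s) = s) ∧
      ∀ r ∈ Icc 0 (z m), σ r ∈ Icc p m ∧ z (σ r) = r := by
  obtain ⟨σ, hσ⟩ := exists_clampedInverse A.lt.le A.cont A.deriv fun _ => A.deriv_pos
  have hright := hσ.right_inv
  have hderiv := hσ.deriv
  rw [A.left] at hright hderiv
  refine ⟨σ, ⟨hσ.cont.continuousOn, fun r hr => ?_, fun r hr => ?_⟩, hσ.left_inv,
    fun r hr => ⟨hσ.mem r, hright r hr⟩⟩
  · have hzσ := hright r (Ico_subset_Icc_self hr)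
    have hlt : σ r < m := (hσ.mem r).2.lt_of_ne fun h => hr.2.ne (by rw [← hzσ, h])
    simpa only [hzσ] using A.below _ ⟨(hσ.mem r).1, hlt⟩
  · simpa only [hright r (Ioo_subset_Icc_self hr)] using hderiv r hr

theorem eq_of_meet (hΨ : Continuous Ψ) (A : Rise Ψ p m z) (B : Rise Ψ p' m' z')
    (hs : s ∈ Icc p m) (hs' : s ∈ Icc p' m') (heq : z s = z' s) :
    p = p' ∧ m = m' ∧ EqOn z z' (Icc p m) := by
  obtain ⟨σ, bσ, hσz, -⟩ := A.exists_branch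
  obtain ⟨τ, bτ, hτz, hzτ⟩ := B.exists_branch
  have hσm : σ (z m) = m := hσz m (right_mem_Icc.2 A.lt.le)
  have hτm : τ (z' m') = m' := hτz m' (right_mem_Icc.2 B.lt.le)
  have hr := A.mem_Icc hs
  have hr' : z s ∈ Icc 0 (z' m') := heq ▸ B.mem_Icc hs'
  have hστ : σ (z s) = τ (z s) := by rw [hσz s hs, heq, hτz s hs']
  have htop : z m = z' m' := le_antisymm
    (bσ.le_of_eq_of_meets_graph hΨ bτ (hτm.trans B.vertex.symm) hr' hστ)
    (bτ.le_of_eq_of_meets_graph hΨ bσ (hσm.trans A.vertex.symm) hr hστ.symm)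
  rw [← htop] at bτ hzτ
  have hbranch : EqOn σ τ (Icc 0 (z m)) := bσ.eqOn_of_eq hΨ bτ hr hστ
  refine ⟨?_, ?_, fun t ht => ?_⟩
  · have := hbranch (A.mem_Icc (left_mem_Icc.2 A.lt.le))
    rwa [hσz p (left_mem_Icc.2 A.lt.le), A.left, ← B.left, hτz p' (left_mem_Icc.2 B.lt.le)] at this
  · rw [← A.vertex, htop, B.vertex]
  · have hzt := A.mem_Icc ht
    rw [← (hzτ _ hzt).2, ← hbranch hzt, hσz t ht]

end Rise

/-- The regularity of `Ψ` that makes arcs of height less than `R` unique. -/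
structure Regular (Ψ : ℝ → ℝ) (R : ℝ) : Prop where
  cont : Continuous Ψ
  zero : Ψ 0 = 0
  diff : ∀ x ∈ Ioo 0 R, DifferentiableAt ℝ Ψ x

theorem Regular.neg {Ψ : ℝ → ℝ} {R : ℝ} (h : Regular Ψ R) : Regular (fun x => -Ψ x) R where
  cont := h.cont.neg
  zero := by rw [h.zero, neg_zero]
  diff x hx := (h.diff x hx).neg

namespace Arc

variable {Ψ : ℝ → ℝ} {R p q p' q' s : ℝ} {z z' : ℝ → ℝ}

theorem exists_rise (hΨ : Regular Ψ R) (A : Arc Ψ p q z) (hR : ∀ s ∈ Ioo p q, z s < R) :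
    ∃ m ∈ Ioo p q, Rise Ψ p m z ∧ Rise (fun x => -Ψ x) (-q) (-m) fun s => z (-s) := by
  have hderiv : ∀ s ∈ Ioo p q, HasDerivAt (fun s => Ψ (z s) - s)
      (_root_.deriv Ψ (z s) * (Ψ (z s) - s) - 1) s := fun s hs =>
    ((hΨ.diff (z s) ⟨A.posIoo s hs, hR s hs⟩).hasDerivAt.comp s (A.deriv s hs)).sub
      (hasDerivAt_id s)
  have hcont : ContinuousOn (fun s => Ψ (z s) - s) (Icc p q) :=
    (hΨ.cont.comp_continuousOn A.cont).sub continuousOn_id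
  obtain ⟨m, hm, hvertex, hbelow, habove⟩ := exists_sign_change_of_deriv_neg_at_zeros A.lt.le
    hcont hderiv (by rw [A.left, hΨ.zero]; linarith [A.neg])
    (by rw [A.right, hΨ.zero]; linarith [A.pos])
    (fun s _ h => by rw [h, mul_zero]; norm_num)
  have hsub : Icc p m ⊆ Icc p q := Icc_subset_Icc_right hm.2.le
  have hsub' : Icc (-q) (-m) ⊆ Icc (-q) (-p) := Icc_subset_Icc_right (neg_le_neg hm.1.le)
  refine ⟨m, hm, ⟨hm.1, A.cont.mono hsub, A.left, fun s hs => sub_pos.1 (hbelow s hs),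
      sub_eq_zero.1 hvertex, fun s hs => A.deriv s ⟨hs.1, hs.2.trans hm.2⟩⟩,
    neg_lt_neg hm.2, A.reflect.cont.mono hsub', A.reflect.left, fun s hs => ?_, ?_,
    fun s hs => A.reflect.deriv s ⟨hs.1, hs.2.trans (neg_lt_neg hm.1)⟩⟩
  · linarith [habove (-s) ⟨lt_neg.2 hs.2, neg_le.2 hs.1⟩]
  · simpa using sub_eq_zero.1 hvertex

theorem eq_of_meet (hΨ : Regular Ψ R) (A : Arc Ψ p q z) (hA : ∀ s ∈ Ioo p q, z s < R)
    (B : Arc Ψ p' q' z') (hB : ∀ s ∈ Ioo p' q', z' s < R) (hs : s ∈ Icc p q)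
    (hs' : s ∈ Icc p' q') (heq : z s = z' s) : p = p' ∧ q = q' ∧ EqOn z z' (Icc p q) := by
  obtain ⟨m, -, Al, Ar⟩ := A.exists_rise hΨ hA
  obtain ⟨n, -, Bl, Br⟩ := B.exists_rise hΨ hB
  suffices hlr : (p = p' ∧ m = n ∧ EqOn z z' (Icc p m)) ∧
      -q = -q' ∧ -m = -n ∧ EqOn (fun s => z (-s)) (fun s => z' (-s)) (Icc (-q) (-m)) by
    obtain ⟨⟨hp, -, hl⟩, hq, -, hr⟩ := hlr
    refine ⟨hp, neg_inj.1 hq, fun t ht => ?_⟩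
    rcases le_total t m with htm | hmt
    · exact hl ⟨ht.1, htm⟩
    · simpa using hr (x := -t) ⟨neg_le_neg ht.2, neg_le_neg hmt⟩
  rcases le_total s m with hsm | hms
  · have hsn : s ≤ n := by
      by_contra! hns
      have hbelow : s ≤ Ψ (z s) := hsm.eq_or_lt.elim (fun h => h ▸ Al.vertex.ge)
        fun h => (Al.below s ⟨hs.1, h⟩).le
      have := Br.below (-s) ⟨neg_le_neg hs'.2, neg_lt_neg hns⟩
      rw [neg_neg, ← heq] at this
      linarith
    have hl := Al.eq_of_meet hΨ.cont Bl ⟨hs.1, hsm⟩ ⟨hs'.1, hsn⟩ heq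
    obtain rfl := hl.2.1
    exact ⟨hl, Ar.eq_of_meet hΨ.neg.cont Br (right_mem_Icc.2 Ar.lt.le) (right_mem_Icc.2 Br.lt.le)
      (by simpa using hl.2.2 (right_mem_Icc.2 Al.lt.le))⟩
  · have hns : n ≤ s := by
      by_contra! hsn
      have habove : Ψ (z s) ≤ s := hms.eq_or_lt.elim (fun h => h ▸ Al.vertex.le) fun h => by
        simpa using (Ar.below (-s) ⟨neg_le_neg hs.2, neg_lt_neg h⟩).le
      have := Bl.below s ⟨hs'.1, hsn⟩
      rw [← heq] at this
      linarith
    have hr := Ar.eq_of_meet hΨ.neg.cont Br (s := -s) ⟨neg_le_neg hs.2, neg_le_neg hms⟩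
      ⟨neg_le_neg hs'.2, neg_le_neg hns⟩ (by simpa using heq)
    obtain rfl := neg_inj.1 hr.2.1
    exact ⟨Al.eq_of_meet hΨ.cont Bl (right_mem_Icc.2 Al.lt.le) (right_mem_Icc.2 Bl.lt.le)
      (by simpa using hr.2.2 (right_mem_Icc.2 Ar.lt.le)), hr⟩

theorem lt_of_lt (hΨ : Regular Ψ R) (A : Arc Ψ p q z) (hA : ∀ s ∈ Ioo p q, z s < R)
    (B : Arc Ψ p' q' z') (hB : ∀ s ∈ Ioo p' q', z' s < R) (hlt : p' < p) :
    q < q' ∧ ∀ s ∈ Icc p q, z s < z' s := by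
  have hlt_on : ∀ b ∈ Icc p q, b ≤ q' → z b < z' b := fun b hb hbq' => by
    by_contra! hge
    have hp : z p < z' p := A.left ▸ B.posIoo p ⟨hlt, A.neg.trans B.pos⟩
    have hcont : ContinuousOn (fun s => z s - z' s) (Icc p b) :=
      (A.cont.mono (Icc_subset_Icc_right hb.2)).sub (B.cont.mono (Icc_subset_Icc hlt.le hbq'))
    obtain ⟨s, hs, hs0⟩ := intermediate_value_Icc hb.1 hcont
      (show (0 : ℝ) ∈ Icc (z p - z' p) (z b - z' b) from ⟨by linarith, by linarith⟩)
    exact hlt.ne' (A.eq_of_meet hΨ hA B hB ⟨hs.1, hs.2.trans hb.2⟩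
      ⟨hlt.le.trans hs.1, hs.2.trans hbq'⟩ (sub_eq_zero.1 hs0)).1
  have hq : q < q' := by
    by_contra! h
    have hmem : q' ∈ Icc p q := ⟨(A.neg.trans B.pos).le, h⟩
    linarith [hlt_on q' hmem le_rfl, A.nonneg hmem, B.right]
  exact ⟨hq, fun s hs => hlt_on s hs (hs.2.trans hq.le)⟩

end Arc

namespace Rise

variable {Ψ : ℝ → ℝ} {p m p' m' a : ℝ} {z z' : ℝ → ℝ}

theorem exists_branch_at_height (A : Rise Ψ p m z) (ha : 0 ≤ a) (ham : a ≤ z m) :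
    ∃ σ, Branch Ψ a σ ∧ σ 0 = p ∧ σ a ∈ Icc p m ∧ z (σ a) = a := by
  obtain ⟨σ, b, hσz, hzσ⟩ := A.exists_branch
  refine ⟨σ, b.mono ham, ?_, hzσ a ⟨ha, ham⟩⟩
  simpa only [A.left] using hσz p (left_mem_Icc.2 A.lt.le)

theorem exists_sq_sub_sq_lt (ha : 0 < a) (hpos : ∀ x ∈ Ioo 0 a, 0 < Ψ x) (A : Rise Ψ p m z)
    (ham : a ≤ z m) (B : Rise Ψ p' m' z') (ham' : a ≤ z' m') (hlt : p' < p) :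
    ∃ s ∈ Icc p m, ∃ s' ∈ Icc p' m', z s = a ∧ z' s' = a ∧ s' < s ∧
      p ^ 2 - p' ^ 2 < s ^ 2 - s' ^ 2 := by
  obtain ⟨σ, b, rfl, hs, hza⟩ := A.exists_branch_at_height ha.le ham
  obtain ⟨τ, c, rfl, hs', hza'⟩ := B.exists_branch_at_height ha.le ham'
  have hord : ∀ r ∈ Icc 0 a, τ r < σ r := fun r => b.lt_of_lt c hlt
  exact ⟨σ a, hs, τ a, hs', hza, hza', hord a (right_mem_Icc.2 ha.le),
    b.sq_sub_sq_lt ha c (fun r hr => hord r (Ioo_subset_Icc_self hr)) hpos⟩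

theorem exists_lt_sq_sub_sq (ha : 0 < a) (hneg : ∀ x ∈ Ioo 0 a, Ψ x < 0) (A : Rise Ψ p m z)
    (ham : a ≤ z m) (B : Rise Ψ p' m' z') (ham' : a ≤ z' m') (hlt : p' < p) :
    ∃ s ∈ Icc p m, ∃ s' ∈ Icc p' m', z s = a ∧ z' s' = a ∧ s' < s ∧
      s ^ 2 - s' ^ 2 < p ^ 2 - p' ^ 2 := by
  obtain ⟨σ, b, rfl, hs, hza⟩ := A.exists_branch_at_height ha.le ham
  obtain ⟨τ, c, rfl, hs', hza'⟩ := B.exists_branch_at_height ha.le ham'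
  have hord : ∀ r ∈ Icc 0 a, τ r < σ r := fun r => b.lt_of_lt c hlt
  exact ⟨σ a, hs, τ a, hs', hza, hza', hord a (right_mem_Icc.2 ha.le),
    b.lt_sq_sub_sq ha c (fun r hr => hord r (Ioo_subset_Icc_self hr)) hneg⟩

variable {Φ : ℝ → ℝ} {q s : ℝ}

theorem le_vertex (A : Rise Ψ p m z) (B : Rise Φ (-q) (-m) fun s => z (-s)) (hs : s ∈ Icc p q) :
    z s ≤ z m := by
  rcases le_total s m with hsm | hms
  · exact (A.mem_Icc ⟨hs.1, hsm⟩).2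
  · simpa using (B.mem_Icc (s := -s) ⟨neg_le_neg hs.2, neg_le_neg hms⟩).2

theorem le_of_mem_Icc {b c : ℝ} (A : Rise Ψ p m z) (B : Rise Φ (-q) (-m) fun s => z (-s))
    (hb : b ∈ Icc p m) (hc : c ∈ Icc (-q) (-m)) (hzb : a ≤ z b) (hzc : a ≤ z (-c))
    (hs : s ∈ Icc b (-c)) : a ≤ z s := by
  rcases le_total s m with hsm | hms
  · exact hzb.trans (A.strictMonoOn.monotoneOn hb ⟨hb.1.trans hs.1, hsm⟩ hs.1)
  · have := B.strictMonoOn.monotoneOn hc (b := -s) ⟨hc.1.trans (le_neg.2 hs.2), neg_le_neg hms⟩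
      (le_neg.2 hs.2)
    simpa using hzc.trans this

end Rise

namespace Arc

variable {Ψ : ℝ → ℝ} {a b c p q p' q' R Y Y' s : ℝ} {z z' : ℝ → ℝ}

theorem hasDerivAt_energy (A : Arc Ψ p q z) (hs : s ∈ Ioo p q) :
    HasDerivAt (fun s => z s + s ^ 2 / 2) (Ψ (z s)) s :=
  ((A.deriv s hs).add (hasDerivAt_sq_div_two s)).congr_deriv (by ring)

theorem continuousOn_energy (A : Arc Ψ p q z) :
    ContinuousOn (fun s => z s + s ^ 2 / 2) (Icc p q) := A.cont.add (by fun_prop)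

theorem energy_le_of_nonpos (A : Arc Ψ p q z) (hpb : p ≤ b) (hbc : b ≤ c) (hcq : c ≤ q)
    (h : ∀ s ∈ Ioo b c, Ψ (z s) ≤ 0) : z c + c ^ 2 / 2 ≤ z b + b ^ 2 / 2 := by
  refine antitoneOn_of_hasDerivWithinAt_nonpos (convex_Icc b c) (f' := fun s => Ψ (z s))
    (A.continuousOn_energy.mono (Icc_subset_Icc hpb hcq)) ?_ ?_ (left_mem_Icc.2 hbc)
    (right_mem_Icc.2 hbc) hbc <;> rw [interior_Icc]
  · exact fun s hs => (A.hasDerivAt_energy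
      ⟨hpb.trans_lt hs.1, hs.2.trans_le hcq⟩).hasDerivWithinAt
  · exact h

theorem energy_sub_le_of_le (A : Arc Ψ p q z) (B : Arc Ψ p' q' z') (hpb : p ≤ b) (hpb' : p' ≤ b)
    (hbc : b ≤ c) (hcq : c ≤ q) (hcq' : c ≤ q') (h : ∀ s ∈ Ioo b c, Ψ (z' s) ≤ Ψ (z s)) :
    (z' c + c ^ 2 / 2) - (z c + c ^ 2 / 2) ≤ (z' b + b ^ 2 / 2) - (z b + b ^ 2 / 2) := by
  refine antitoneOn_of_hasDerivWithinAt_nonpos (convex_Icc b c)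
    (f' := fun s => Ψ (z' s) - Ψ (z s))
    ((B.continuousOn_energy.mono (Icc_subset_Icc hpb' hcq')).sub
      (A.continuousOn_energy.mono (Icc_subset_Icc hpb hcq)))
    ?_ ?_ (left_mem_Icc.2 hbc) (right_mem_Icc.2 hbc) hbc <;> rw [interior_Icc]
  · exact fun s hs => ((B.hasDerivAt_energy ⟨hpb'.trans_lt hs.1, hs.2.trans_le hcq'⟩).sub
      (A.hasDerivAt_energy ⟨hpb.trans_lt hs.1, hs.2.trans_le hcq⟩)).hasDerivWithinAt
  · exact fun s hs => sub_nonpos.2 (h s hs)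

theorem exists_le_of_symmetric (A : Arc Ψ (-Y) Y z) (hpos : ∀ x ∈ Ioo 0 a, 0 < Ψ x) :
    ∃ s ∈ Ioo (-Y) Y, a ≤ z s := by
  obtain ⟨s, hs, h0⟩ := exists_hasDerivAt_eq_zero (f := fun s => z s + s ^ 2 / 2) A.lt
    A.continuousOn_energy (by rw [A.left, A.right, neg_sq]) fun s hs => A.hasDerivAt_energy hs
  refine ⟨s, hs, ?_⟩
  by_contra! hlt
  exact (hpos _ ⟨A.posIoo s hs, hlt⟩).ne' h0

-- Below the height `a`, where `Ψ > 0`, the larger arc gains less energy than the smaller one;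
-- above it, where `Ψ ≤ 0` decreases, it loses more. But both arcs recover their initial energy.
theorem not_lt_of_symmetric (hΨ : Regular Ψ R) (ha : 0 < a) (hpos : ∀ x ∈ Ioo 0 a, 0 < Ψ x)
    (hneg : ∀ x ∈ Ico a R, Ψ x ≤ 0) (hanti : AntitoneOn Ψ (Ico a R))
    (A : Arc Ψ (-Y) Y z) (hA : ∀ s ∈ Ioo (-Y) Y, z s < R)
    (B : Arc Ψ (-Y') Y' z') (hB : ∀ s ∈ Ioo (-Y') Y', z' s < R) : ¬ Y < Y' := by
  intro hlt
  obtain ⟨-, hord⟩ := A.lt_of_lt hΨ hA B hB (neg_lt_neg hlt)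
  obtain ⟨m, -, Al, Ar⟩ := A.exists_rise hΨ hA
  obtain ⟨m', -, Bl, Br⟩ := B.exists_rise hΨ hB
  obtain ⟨s₀, hs₀, has₀⟩ := A.exists_le_of_symmetric hpos
  have hs₀' : s₀ ∈ Icc (-Y') Y' := ⟨by linarith [hs₀.1], by linarith [hs₀.2]⟩
  have ham : a ≤ z m := has₀.trans (Al.le_vertex Ar (Ioo_subset_Icc_self hs₀))
  have ham' : a ≤ z' m' :=
    has₀.trans ((hord s₀ (Ioo_subset_Icc_self hs₀)).le.trans (Bl.le_vertex Br hs₀'))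
  obtain ⟨b, hb, b', hb', hzb, hzb', hbb', hgainl⟩ :=
    Al.exists_sq_sub_sq_lt ha hpos ham Bl ham' (neg_lt_neg hlt)
  obtain ⟨c, hc, c', hc', hzc, hzc', hcc', hgainr⟩ :=
    Ar.exists_lt_sq_sub_sq ha (fun x hx => neg_lt_zero.2 (hpos x hx)) (by rwa [neg_neg]) Br
      (by rwa [neg_neg]) (neg_lt_neg hlt)
  have hbc : b ≤ -c := hb.2.trans (le_neg.2 hc.2)
  have hcY : -c ≤ Y := neg_le.2 hc.1
  have hcY' : -c' ≤ Y' := neg_le.2 hc'.1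
  have habove : ∀ s ∈ Icc b (-c), a ≤ z s := fun s =>
    Al.le_of_mem_Icc Ar hb hc hzb.ge hzc.ge
  have habove' : ∀ s ∈ Ioo b' (-c'), z' s ∈ Ico a R := fun s hs =>
    ⟨Bl.le_of_mem_Icc Br hb' hc' hzb'.ge hzc'.ge (Ioo_subset_Icc_self hs),
      hB s ⟨hb'.1.trans_lt hs.1, hs.2.trans_le hcY'⟩⟩
  have hleft := B.energy_le_of_nonpos hb'.1 hbb'.le (by linarith [hb.1])
    fun s hs => hneg _ (habove' s ⟨hs.1, by linarith [hs.2]⟩)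
  have hright := B.energy_le_of_nonpos (b := -c) (c := -c') (by linarith [hb'.1]) (by linarith)
    hcY' fun s hs => hneg _ (habove' s ⟨by linarith [hs.1], hs.2⟩)
  have hmiddle := A.energy_sub_le_of_le B hb.1 (by linarith [hb'.1]) hbc hcY (by linarith)
    fun s hs => hanti ⟨habove s (Ioo_subset_Icc_self hs),
      hA s ⟨hb.1.trans_lt hs.1, hs.2.trans_le hcY⟩⟩
      (habove' s ⟨by linarith [hs.1], by linarith [hs.2]⟩)
      (hord s ⟨hb.1.trans hs.1.le, hs.2.le.trans hcY⟩).le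
  rw [hzb, hzc] at hmiddle
  rw [hzb'] at hleft
  rw [hzc'] at hright
  nlinarith

theorem symmetric_unique (hΨ : Regular Ψ R) (ha : 0 < a) (hpos : ∀ x ∈ Ioo 0 a, 0 < Ψ x)
    (hneg : ∀ x ∈ Ico a R, Ψ x ≤ 0) (hanti : AntitoneOn Ψ (Ico a R))
    (A : Arc Ψ (-Y) Y z) (hA : ∀ s ∈ Ioo (-Y) Y, z s < R)
    (B : Arc Ψ (-Y') Y' z') (hB : ∀ s ∈ Ioo (-Y') Y', z' s < R) :
    Y = Y' ∧ EqOn z z' (Icc (-Y) Y) := by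
  obtain rfl : Y = Y' := le_antisymm
    (not_lt.1 (B.not_lt_of_symmetric hΨ ha hpos hneg hanti hB A hA))
    (not_lt.1 (A.not_lt_of_symmetric hΨ ha hpos hneg hanti hA B hB))
  exact ⟨rfl, (A.eq_of_meet hΨ hA B hB (left_mem_Icc.2 A.lt.le) (left_mem_Icc.2 A.lt.le)
    (by rw [A.left, B.left])).2.2⟩

end Arc

section SymInterval

variable {d : EReal} {x y b : ℝ}

theorem isOpen_symInterval (d : EReal) : IsOpen (symInterval d) :=
  isOpen_lt (continuous_coe_real_ereal.comp continuous_abs) continuous_const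

theorem mem_symInterval_of_abs_le (hy : y ∈ symInterval d) (h : |x| ≤ |y|) : x ∈ symInterval d :=
  lt_of_le_of_lt (EReal.coe_le_coe_iff.2 h) hy

theorem neg_mem_symInterval (hx : x ∈ symInterval d) : -x ∈ symInterval d :=
  mem_symInterval_of_abs_le hx (abs_neg x).le

theorem Icc_subset_symInterval (hb : b ∈ symInterval d) : Icc 0 b ⊆ symInterval d := fun _ hx =>
  mem_symInterval_of_abs_le hb (abs_le_abs_of_nonneg hx.1 hx.2)

theorem uIcc_subset_symInterval (hx : x ∈ symInterval d) : uIcc 0 x ⊆ symInterval d := fun t ht =>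
  mem_symInterval_of_abs_le hx (by simpa using abs_sub_left_of_mem_uIcc ht)

end SymInterval

section Primitive

variable {h : ℝ → ℝ} {d : EReal} {x : ℝ}

@[simp] theorem primitive_zero (h : ℝ → ℝ) : primitive h 0 = 0 := by simp [primitive]

theorem hasDerivAt_primitive (hh : ContinuousOn h (symInterval d)) (hx : x ∈ symInterval d) :
    HasDerivAt (primitive h) (h x) x :=
  intervalIntegral.integral_hasDerivAt_right
    (hh.mono (uIcc_subset_symInterval hx)).intervalIntegrable
    (hh.stronglyMeasurableAtFilter (isOpen_symInterval d) x hx)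
    (hh.continuousAt ((isOpen_symInterval d).mem_nhds hx))

theorem continuousOn_primitive (hh : ContinuousOn h (symInterval d)) :
    ContinuousOn (primitive h) (symInterval d) :=
  fun _ hx => (hasDerivAt_primitive hh hx).continuousAt.continuousWithinAt

theorem primitive_neg_of_odd (hodd : ∀ x ∈ symInterval d, h (-x) = -h x)
    (hx : x ∈ symInterval d) : primitive h (-x) = primitive h x := by
  have hcongr : ∀ t ∈ uIcc 0 (-x), h t = -h (-t) := fun t ht => by
    rw [hodd t (uIcc_subset_symInterval (neg_mem_symInterval hx) ht), neg_neg]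
  rw [primitive, intervalIntegral.integral_congr hcongr, intervalIntegral.integral_neg,
    intervalIntegral.integral_comp_neg (fun t => h t), neg_neg, neg_zero,
    intervalIntegral.integral_symm, neg_neg, primitive]

end Primitive

/-- The standing regularity, symmetry and sign hypotheses on the Liénard equation. -/
structure OddSystem (f g : ℝ → ℝ) (d : EReal) : Prop where
  f_cont : ContinuousOn f (symInterval d)
  g_cont : ContinuousOn g (symInterval d)
  F_odd : ∀ x ∈ symInterval d, primitive f (-x) = -primitive f x
  g_odd : ∀ x ∈ symInterval d, g (-x) = -g x
  g_pos : ∀ x ∈ symInterval d, 0 < x → 0 < g x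

/-- `X` is the inverse of the potential `G` on `[0, b]`, constant outside `[0, G b]`. -/
abbrev PotentialInverse (g : ℝ → ℝ) (b : ℝ) (X : ℝ → ℝ) : Prop :=
  ClampedInverse (primitive g) g 0 b X

/-- The function `Ψ = -F ∘ G⁻¹` of the transformed equation `dz/ds = Ψ z - s`, which an orbit in
`x ≥ 0` satisfies in the coordinates `s = -y`, `z = G x`; here `X` stands for `G⁻¹`. -/
def transform (f : ℝ → ℝ) (X : ℝ → ℝ) (r : ℝ) : ℝ := -primitive f (X r)

namespace OddSystem

variable {f g : ℝ → ℝ} {d : EReal} {b : ℝ} {X : ℝ → ℝ}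

theorem hasDerivAt_F (H : OddSystem f g d) {x : ℝ} (hx : x ∈ symInterval d) :
    HasDerivAt (primitive f) (f x) x := hasDerivAt_primitive H.f_cont hx

theorem hasDerivAt_G (H : OddSystem f g d) {x : ℝ} (hx : x ∈ symInterval d) :
    HasDerivAt (primitive g) (g x) x := hasDerivAt_primitive H.g_cont hx

theorem continuousOn_F (H : OddSystem f g d) : ContinuousOn (primitive f) (symInterval d) :=
  continuousOn_primitive H.f_cont

theorem continuousOn_G (H : OddSystem f g d) : ContinuousOn (primitive g) (symInterval d) :=
  continuousOn_primitive H.g_cont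

theorem strictMonoOn_G (H : OddSystem f g d) (hb : b ∈ symInterval d) :
    StrictMonoOn (primitive g) (Icc 0 b) :=
  have hsub := Icc_subset_symInterval hb
  strictMonoOn_Icc_of_deriv_pos (H.continuousOn_G.mono hsub)
    (fun _ hx => H.hasDerivAt_G (hsub (Ioo_subset_Icc_self hx)))
    fun x hx => H.g_pos x (hsub (Ioo_subset_Icc_self hx)) hx.1

theorem G_pos (H : OddSystem f g d) (hb : b ∈ symInterval d) (h0 : 0 < b) : 0 < primitive g b :=
  primitive_zero g ▸ H.strictMonoOn_G hb (left_mem_Icc.2 h0.le) (right_mem_Icc.2 h0.le) h0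

theorem exists_potentialInverse (H : OddSystem f g d) (h0 : 0 ≤ b) (hb : b ∈ symInterval d) :
    ∃ X, PotentialInverse g b X :=
  have hsub := Icc_subset_symInterval hb
  exists_clampedInverse h0 (H.continuousOn_G.mono hsub)
    (fun _ hx => H.hasDerivAt_G (hsub (Ioo_subset_Icc_self hx)))
    fun x hx => H.g_pos x (hsub (Ioo_subset_Icc_self hx)) hx.1

theorem continuous_transform (H : OddSystem f g d) (hb : b ∈ symInterval d)
    (hX : PotentialInverse g b X) : Continuous (transform f X) :=
  (H.continuousOn_F.comp_continuous hX.cont fun r => Icc_subset_symInterval hb (hX.mem r)).neg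

end OddSystem

section Transform

variable {f g : ℝ → ℝ} {d : EReal} {b : ℝ} {X : ℝ → ℝ}

theorem transform_of_nonpos (hX : PotentialInverse g b X) {r : ℝ} (hr : r ≤ 0) :
    transform f X r = 0 := by
  rw [transform, hX.of_le r (by rwa [primitive_zero]), primitive_zero, neg_zero]

theorem transform_primitive (hX : PotentialInverse g b X) {x : ℝ} (hx : x ∈ Icc 0 b) :
    transform f X (primitive g x) = -primitive f x := by
  rw [transform, hX.left_inv x hx]

theorem transform_projIcc (hX : PotentialInverse g b X) (h : 0 ≤ primitive g b) (r : ℝ) :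
    transform f X (projIcc 0 (primitive g b) h r) = transform f X r := by
  rcases le_total r 0 with h0 | h0
  · rw [projIcc_of_le_left h h0, transform_of_nonpos hX h0, transform_of_nonpos hX le_rfl]
  rcases le_total (primitive g b) r with h1 | h1
  · rw [projIcc_of_right_le h h1, transform, transform, hX.of_ge r h1, hX.of_ge _ le_rfl]
  · rw [projIcc_of_mem h ⟨h0, h1⟩]

theorem OddSystem.regular_transform (H : OddSystem f g d) (hb : b ∈ symInterval d)
    (hX : PotentialInverse g b X) : Regular (transform f X) (primitive g b) where
  cont := H.continuous_transform hb hX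
  zero := transform_of_nonpos hX le_rfl
  diff r hr :=
    ((H.hasDerivAt_F (Icc_subset_symInterval hb (hX.mem r))).comp r
      (hX.deriv r (by rwa [primitive_zero]))).differentiableAt.neg

end Transform

/-- The point with coordinates `s = -y`, `z s = G x` of the Liénard plane; `X` stands for `G⁻¹`. -/
def arcPoint (X z : ℝ → ℝ) (s : ℝ) : ℝ × ℝ := (X (z s), -s)

/-- `γ` solves the Liénard system on `[t₀, t₁]`, runs from the positive to the negative half of the
`y`-axis, and stays in `0 < x < b` in between. -/
structure HalfOrbit (f g : ℝ → ℝ) (b t₀ t₁ : ℝ) (γ : ℝ → ℝ × ℝ) : Prop where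
  lt : t₀ < t₁
  deriv : ∀ t ∈ Icc t₀ t₁, HasDerivWithinAt γ (lienardField f g (γ t)) (Icc t₀ t₁) t
  start_fst : (γ t₀).1 = 0
  finish_fst : (γ t₁).1 = 0
  fst_pos : ∀ t ∈ Ioo t₀ t₁, 0 < (γ t).1
  fst_lt : ∀ t ∈ Icc t₀ t₁, (γ t).1 < b
  start_snd : 0 < (γ t₀).2
  finish_snd : (γ t₁).2 < 0

namespace HalfOrbit

variable {f g X : ℝ → ℝ} {d : EReal} {b t₀ t₁ t : ℝ} {γ : ℝ → ℝ × ℝ}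

theorem fst_mem (O : HalfOrbit f g b t₀ t₁ γ) (ht : t ∈ Icc t₀ t₁) : (γ t).1 ∈ Icc 0 b := by
  refine ⟨?_, (O.fst_lt t ht).le⟩
  rcases ht.1.eq_or_lt with rfl | h0
  · exact O.start_fst.ge
  rcases ht.2.eq_or_lt with rfl | h1
  · exact O.finish_fst.ge
  exact (O.fst_pos t ⟨h0, h1⟩).le

theorem continuousOn (O : HalfOrbit f g b t₀ t₁ γ) : ContinuousOn γ (Icc t₀ t₁) :=
  HasDerivWithinAt.continuousOn O.deriv

theorem hasDerivAt (O : HalfOrbit f g b t₀ t₁ γ) (ht : t ∈ Ioo t₀ t₁) :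
    HasDerivAt γ (lienardField f g (γ t)) t :=
  (O.deriv t (Ioo_subset_Icc_self ht)).hasDerivAt (Icc_mem_nhds ht.1 ht.2)

theorem hasDerivAt_neg_snd (O : HalfOrbit f g b t₀ t₁ γ) (ht : t ∈ Ioo t₀ t₁) :
    HasDerivAt (fun t => -(γ t).2) (g (γ t).1) t :=
  (neg_neg (g (γ t).1)) ▸ (show HasDerivAt (fun t => (γ t).2) (-g (γ t).1) t from
    (O.hasDerivAt ht).snd).neg

theorem g_pos (O : HalfOrbit f g b t₀ t₁ γ) (H : OddSystem f g d) (hb : b ∈ symInterval d)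
    (ht : t ∈ Ioo t₀ t₁) : 0 < g (γ t).1 :=
  H.g_pos _ (Icc_subset_symInterval hb (O.fst_mem (Ioo_subset_Icc_self ht))) (O.fst_pos t ht)

theorem continuousOn_neg_snd (O : HalfOrbit f g b t₀ t₁ γ) :
    ContinuousOn (fun t => -(γ t).2) (Icc t₀ t₁) :=
  (continuous_snd.comp_continuousOn O.continuousOn).neg

theorem exists_clampedInverse (O : HalfOrbit f g b t₀ t₁ γ) (H : OddSystem f g d)
    (hb : b ∈ symInterval d) :
    ∃ k, ClampedInverse (fun t => -(γ t).2) (fun t => g (γ t).1) t₀ t₁ k :=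
  Lienard.exists_clampedInverse O.lt.le O.continuousOn_neg_snd (fun _ => O.hasDerivAt_neg_snd)
    fun _ => O.g_pos H hb

theorem arc (O : HalfOrbit f g b t₀ t₁ γ) (H : OddSystem f g d) (hb : b ∈ symInterval d)
    (hX : PotentialInverse g b X) {k : ℝ → ℝ}
    (hk : ClampedInverse (fun t => -(γ t).2) (fun t => g (γ t).1) t₀ t₁ k) :
    Arc (transform f X) (-(γ t₀).2) (-(γ t₁).2) fun s => primitive g (γ (k s)).1 where
  neg := neg_lt_zero.2 O.start_snd
  pos := neg_pos.2 O.finish_snd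
  cont := H.continuousOn_G.comp
    ((continuous_fst.comp_continuousOn O.continuousOn).comp hk.cont.continuousOn
      fun s _ => hk.mem s)
    fun s _ => Icc_subset_symInterval hb (O.fst_mem (hk.mem s))
  left := by rw [hk.left_inv t₀ (left_mem_Icc.2 O.lt.le), O.start_fst, primitive_zero]
  right := by rw [hk.left_inv t₁ (right_mem_Icc.2 O.lt.le), O.finish_fst, primitive_zero]
  posIoo s hs :=
    H.G_pos (Icc_subset_symInterval hb (O.fst_mem (hk.mem s))) (O.fst_pos _ (hk.mem_Ioo s hs))
  deriv s hs := by
    have hks := hk.mem_Ioo s hs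
    have hmem := O.fst_mem (hk.mem s)
    have hsnd : -(γ (k s)).2 = s := hk.right_inv s (Ioo_subset_Icc_self hs)
    have hd := (H.hasDerivAt_G (Icc_subset_symInterval hb hmem)).comp s
      (HasDerivAt.comp s (show HasDerivAt (fun t => (γ t).1) _ (k s) from (O.hasDerivAt hks).fst)
        (hk.deriv s hs))
    refine hd.congr_deriv ?_
    rw [transform_primitive hX hmem]
    have hg := (O.g_pos H hb hks).ne'
    simp only [lienardField]
    field_simp
    linarith

theorem exists_arc (O : HalfOrbit f g b t₀ t₁ γ) (H : OddSystem f g d) (hb : b ∈ symInterval d)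
    (hX : PotentialInverse g b X) :
    ∃ z, Arc (transform f X) (-(γ t₀).2) (-(γ t₁).2) z ∧
      (∀ s ∈ Icc (-(γ t₀).2) (-(γ t₁).2), z s < primitive g b) ∧
      γ '' Icc t₀ t₁ = arcPoint X z '' Icc (-(γ t₀).2) (-(γ t₁).2) := by
  obtain ⟨k, hk⟩ := O.exists_clampedInverse H hb
  have hmono := strictMonoOn_Icc_of_deriv_pos O.continuousOn_neg_snd
    (fun _ => O.hasDerivAt_neg_snd) fun _ => O.g_pos H hb
  have hpoint : ∀ s ∈ Icc (-(γ t₀).2) (-(γ t₁).2),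
      arcPoint X (fun s => primitive g (γ (k s)).1) s = γ (k s) := fun s hs =>
    Prod.ext (hX.left_inv _ (O.fst_mem (hk.mem s))) (neg_eq_iff_eq_neg.2 (hk.right_inv s hs).symm)
  refine ⟨_, O.arc H hb hX hk, fun s _ => ?_, Subset.antisymm ?_ ?_⟩
  · have hmem := O.fst_mem (hk.mem s)
    exact H.strictMonoOn_G hb hmem (right_mem_Icc.2 (hmem.1.trans hmem.2)) (O.fst_lt _ (hk.mem s))
  · rintro _ ⟨t, ht, rfl⟩
    have hs : -(γ t).2 ∈ Icc (-(γ t₀).2) (-(γ t₁).2) :=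
      ⟨hmono.monotoneOn (left_mem_Icc.2 O.lt.le) ht ht.1,
        hmono.monotoneOn ht (right_mem_Icc.2 O.lt.le) ht.2⟩
    exact ⟨_, hs, (hpoint _ hs).trans (congrArg γ (hk.left_inv t ht))⟩
  · rintro _ ⟨s, hs, rfl⟩
    exact ⟨k s, hk.mem s, (hpoint s hs).symm⟩

end HalfOrbit

section TimeChange

variable {x ζ φ : ℝ → ℝ} {p q δ : ℝ}

theorem integrableOn_of_hasDerivAt_mul (hx : ContinuousOn x (Icc p q))
    (hd : ∀ s ∈ Ioo p q, HasDerivAt x (ζ s * φ s) s) (hζ : ∀ s ∈ Ioo p q, 0 < ζ s)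
    (hζc : ContinuousOn ζ (Ioo p q)) (hδ : 0 < δ) (hφ : ∀ s ∈ Ioo p q, δ ≤ φ s) :
    MeasureTheory.IntegrableOn ζ (Ioo p q) := by
  have hint : MeasureTheory.IntegrableOn (fun s => ζ s * φ s) (Ioo p q) :=
    (intervalIntegral.integrableOn_deriv_of_nonneg hx hd
      fun s hs => mul_nonneg (hζ s hs).le (hδ.le.trans (hφ s hs))).mono_set Ioo_subset_Ioc_self
  refine (hint.const_mul δ⁻¹).mono' (hζc.aestronglyMeasurable measurableSet_Ioo) ?_
  rw [MeasureTheory.ae_restrict_iff' measurableSet_Ioo]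
  refine .of_forall fun s hs => ?_
  rw [Real.norm_of_nonneg (hζ s hs).le, le_inv_mul_iff₀ hδ, mul_comm]
  exact mul_le_mul_of_nonneg_left (hφ s hs) (hζ s hs).le

theorem exists_integrableOn_left_of_hasDerivAt_mul (hpq : p < q) (hx : ContinuousOn x (Icc p q))
    (hd : ∀ s ∈ Ioo p q, HasDerivAt x (ζ s * φ s) s) (hζ : ∀ s ∈ Ioo p q, 0 < ζ s)
    (hζc : ContinuousOn ζ (Ioo p q)) (hφ : ContinuousWithinAt φ (Icc p q) p) (hp : 0 < φ p) :
    ∃ c ∈ Ioo p q, MeasureTheory.IntegrableOn ζ (Ioo p c) := by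
  have htend : Tendsto φ (𝓝[>] p) (𝓝 (φ p)) :=
    nhdsWithin_Ioo_eq_nhdsGT hpq ▸ hφ.mono Ioo_subset_Icc_self
  obtain ⟨c, hc, hsub⟩ := mem_nhdsGT_iff_exists_Ioc_subset.1
    ((htend.eventually_const_lt (half_lt_self hp)).and (Ioo_mem_nhdsGT hpq))
  have hcq : c < q := (hsub ⟨hc, le_rfl⟩).2.2
  have hIoo : Ioo p c ⊆ Ioo p q := Ioo_subset_Ioo_right hcq.le
  exact ⟨c, ⟨hc, hcq⟩, integrableOn_of_hasDerivAt_mul (hx.mono (Icc_subset_Icc_right hcq.le))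
    (fun s hs => hd s (hIoo hs)) (fun s hs => hζ s (hIoo hs)) (hζc.mono hIoo) (half_pos hp)
    fun s hs => (hsub ⟨hs.1, hs.2.le⟩).1.le⟩

theorem integrableOn_of_hasDerivAt_mul_of_sign (hpq : p < q) (hx : ContinuousOn x (Icc p q))
    (hd : ∀ s ∈ Ioo p q, HasDerivAt x (ζ s * φ s) s) (hζ : ∀ s ∈ Ioo p q, 0 < ζ s)
    (hζc : ContinuousOn ζ (Ioo p q)) (hφ : ContinuousOn φ (Icc p q)) (hp : 0 < φ p)
    (hq : φ q < 0) : MeasureTheory.IntegrableOn ζ (Ioo p q) := by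
  obtain ⟨c, hc, hleft⟩ := exists_integrableOn_left_of_hasDerivAt_mul hpq hx hd hζ hζc
    (hφ p (left_mem_Icc.2 hpq.le)) hp
  have hIcc : MapsTo Neg.neg (Icc (-q) (-p)) (Icc p q) := fun s hs =>
    ⟨le_neg.2 hs.2, neg_le.2 hs.1⟩
  have hIoo : MapsTo Neg.neg (Ioo (-q) (-p)) (Ioo p q) := fun s hs =>
    ⟨lt_neg.2 hs.2, neg_lt.2 hs.1⟩
  obtain ⟨e, he, hright⟩ := exists_integrableOn_left_of_hasDerivAt_mul (neg_lt_neg hpq)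
    (x := fun s => x (-s)) (ζ := fun s => ζ (-s)) (φ := fun s => -φ (-s))
    (hx.comp continuousOn_neg hIcc)
    (fun s hs => ((hd _ (hIoo hs)).comp s (hasDerivAt_neg s)).congr_deriv (by ring))
    (fun s hs => hζ _ (hIoo hs)) (hζc.comp continuousOn_neg hIoo)
    ((hφ.comp continuousOn_neg hIcc).neg _ (left_mem_Icc.2 (neg_le_neg hpq.le)))
    (by rwa [neg_neg, neg_pos])
  have hright' : MeasureTheory.IntegrableOn ζ (Ioo (-e) q) := by
    simpa only [Function.comp_def, neg_neg, image_neg_eq_neg, neg_Ioo, neg_neg] using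
      ((MeasureTheory.Measure.measurePreserving_neg MeasureTheory.volume).integrableOn_image
        (Homeomorph.neg ℝ).measurableEmbedding (f := ζ) (s := Ioo (-q) e)).2 hright
  have hmid : MeasureTheory.IntegrableOn ζ (Icc c (-e)) :=
    (hζc.mono fun s hs => ⟨hc.1.trans_le hs.1, hs.2.trans_lt (neg_lt.2 he.1)⟩).integrableOn_Icc
  refine ((hleft.union hmid).union hright').mono_set fun s hs => ?_
  rcases lt_or_ge s c with hsc | hcs
  · exact Or.inl (Or.inl ⟨hs.1, hsc⟩)
  rcases le_or_gt s (-e) with hse | hes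
  · exact Or.inl (Or.inr ⟨hcs, hse⟩)
  · exact Or.inr ⟨hes, hs.2⟩

theorem exists_time_change (hpq : p < q) (hint : MeasureTheory.IntegrableOn ζ (Ioo p q))
    (hζ : ∀ s ∈ Ioo p q, 0 < ζ s) (hζc : ContinuousOn ζ (Ioo p q)) :
    ∃ T > 0, ∃ S : ℝ → ℝ, Continuous S ∧ S '' Icc 0 T = Icc p q ∧ S 0 = p ∧ S T = q ∧
      ∀ t ∈ Ioo 0 T, S t ∈ Ioo p q ∧ HasDerivAt S (ζ (S t))⁻¹ t := by
  have hI : IntervalIntegrable ζ MeasureTheory.volume p q :=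
    (intervalIntegrable_iff_integrableOn_Ioo_of_le hpq.le).2 hint
  set τ : ℝ → ℝ := fun s => ∫ r in p..s, ζ r with hτ
  have hτc : ContinuousOn τ (Icc p q) :=
    uIcc_of_le hpq.le ▸ intervalIntegral.continuousOn_primitive_interval' hI left_mem_uIcc
  have hτd : ∀ s ∈ Ioo p q, HasDerivAt τ (ζ s) s := fun s hs => by
    refine intervalIntegral.integral_hasDerivAt_right (hI.mono_set ?_)
      (hζc.stronglyMeasurableAtFilter isOpen_Ioo s hs) (hζc.continuousAt (Ioo_mem_nhds hs.1 hs.2))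
    rw [uIcc_of_le hs.1.le, uIcc_of_le hpq.le]
    exact Icc_subset_Icc_right hs.2.le
  have hτp : τ p = 0 := by simp only [hτ, intervalIntegral.integral_same]
  have hp := left_mem_Icc.2 hpq.le
  have hq := right_mem_Icc.2 hpq.le
  have hτm := strictMonoOn_Icc_of_deriv_pos hτc hτd hζ
  obtain ⟨S, hS⟩ := exists_clampedInverse hpq.le hτc hτd hζ
  refine ⟨τ q, hτp ▸ hτm hp hq hpq, S, hS.cont, Subset.antisymm ?_ fun s hs => ?_,
    hτp ▸ hS.left_inv p hp, hS.left_inv q hq, fun t ht => ?_⟩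
  · rintro _ ⟨t, -, rfl⟩
    exact hS.mem t
  · exact ⟨τ s, ⟨hτp ▸ hτm.monotoneOn hp hs hs.1, hτm.monotoneOn hs hq hs.2⟩, hS.left_inv s hs⟩
  · rw [← hτp] at ht
    exact ⟨hS.mem_Ioo t ht, hS.deriv t ht⟩

end TimeChange

section AntiperiodicExtension

variable {E : Type*} [NormedAddCommGroup E] [NormedSpace ℝ E] {γ : ℝ → E} {V : E → E} {T t : ℝ}

/-- The extension of `γ`, given on `[0, T)`, to a function of antiperiod `T`. -/
def antiperiodicExtension (γ : ℝ → E) (T t : ℝ) : E :=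
  ((-1 : ℝ) ^ ⌊t / T⌋) • γ (t - ⌊t / T⌋ * T)

theorem antiperiodicExtension_antiperiodic (γ : ℝ → E) (hT : T ≠ 0) :
    Function.Antiperiodic (antiperiodicExtension γ T) T := fun t => by
  have hfloor : ⌊(t + T) / T⌋ = ⌊t / T⌋ + 1 := by rw [add_div, div_self hT, Int.floor_add_one]
  have harg : t + T - ((⌊t / T⌋ + 1 : ℤ) : ℝ) * T = t - ⌊t / T⌋ * T := by push_cast; ring
  rw [antiperiodicExtension, hfloor, harg, zpow_add_one₀ (by norm_num), mul_neg_one, neg_smul,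
    antiperiodicExtension]

theorem antiperiodicExtension_of_mem_Icc (hT : 0 < T) (hanti : γ T = -γ 0) (ht : t ∈ Icc 0 T) :
    antiperiodicExtension γ T t = γ t := by
  rcases ht.2.eq_or_lt with rfl | hlt
  · simp [antiperiodicExtension, hT.ne', hanti]
  · have hfloor : ⌊t / T⌋ = 0 := Int.floor_eq_zero_iff.2 ⟨by have := ht.1; positivity,
      (div_lt_one hT).2 hlt⟩
    simp [antiperiodicExtension, hfloor]

theorem range_antiperiodicExtension (hT : 0 < T) (hanti : γ T = -γ 0) :
    range (antiperiodicExtension γ T) = γ '' Icc 0 T ∪ -(γ '' Icc 0 T) := by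
  have heta := antiperiodicExtension_antiperiodic γ hT.ne'
  have hIcc : ∀ t ∈ Icc 0 T, antiperiodicExtension γ T t = γ t := fun t =>
    antiperiodicExtension_of_mem_Icc hT hanti
  refine Subset.antisymm ?_ (union_subset ?_ ?_)
  · have hper : Function.Periodic
        (fun t => antiperiodicExtension γ T t ∈ γ '' Icc 0 T ∪ -(γ '' Icc 0 T)) T := fun t => by
      simp only [heta t, mem_union, Set.mem_neg, neg_neg, or_comm]
    rintro _ ⟨t, rfl⟩
    obtain ⟨s, hs, hts⟩ := hper.exists_mem_Ico₀ hT t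
    have hs' := Ico_subset_Icc_self hs
    exact hts.mpr (Or.inl ⟨s, hs', (hIcc s hs').symm⟩)
  · rintro _ ⟨t, ht, rfl⟩
    exact ⟨t, hIcc t ht⟩
  · rintro P ⟨t, ht, htP⟩
    exact ⟨t + T, by rw [heta t, hIcc t ht, htP, neg_neg]⟩

theorem hasDerivAt_antiperiodicExtension_of_mem_Ico (hT : 0 < T)
    (hγ : ∀ t ∈ Icc 0 T, HasDerivWithinAt γ (V (γ t)) (Icc 0 T) t) (hanti : γ T = -γ 0)
    (hodd : V (-γ 0) = -V (γ 0)) (ht : t ∈ Ico 0 T) :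
    HasDerivAt (antiperiodicExtension γ T) (V (γ t)) t := by
  have hIcc : ∀ t ∈ Icc 0 T, antiperiodicExtension γ T t = γ t := fun t =>
    antiperiodicExtension_of_mem_Icc hT hanti
  have ht' := Ico_subset_Icc_self ht
  have hright := (hγ t ht').congr hIcc (hIcc t ht')
  rcases ht.1.eq_or_lt with rfl | ht0
  swap
  · exact hright.hasDerivAt (Icc_mem_nhds ht0 ht.2)
  have hmaps : MapsTo (· + T) (Icc (-T) 0) (Icc 0 T) := fun t ht => by
    constructor <;> linarith [ht.1, ht.2]
  have heq : ∀ t ∈ Icc (-T) 0, antiperiodicExtension γ T t = -γ (t + T) := fun t ht => by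
    rw [← hIcc _ (hmaps ht), antiperiodicExtension_antiperiodic γ hT.ne', neg_neg]
  have h0 : (0 : ℝ) ∈ Icc (-T) 0 := right_mem_Icc.2 (neg_nonpos.2 hT.le)
  have hleft : HasDerivWithinAt (antiperiodicExtension γ T) (V (γ 0)) (Icc (-T) 0) 0 := by
    have hd := (hγ _ (hmaps h0)).scomp (0 : ℝ) ((hasDerivAt_id _).add_const T).hasDerivWithinAt
      hmaps
    simp only [zero_add, hanti, hodd, one_smul] at hd
    simpa only [neg_neg] using hd.neg.congr heq (heq 0 h0)
  refine (hleft.union hright).hasDerivAt ?_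
  rw [Icc_union_Icc_eq_Icc (by linarith) hT.le]
  exact Icc_mem_nhds (neg_lt_zero.2 hT) hT

theorem hasDerivAt_antiperiodicExtension (hT : 0 < T)
    (hγ : ∀ t ∈ Icc 0 T, HasDerivWithinAt γ (V (γ t)) (Icc 0 T) t) (hanti : γ T = -γ 0)
    (hodd : ∀ t ∈ Icc 0 T, V (-γ t) = -V (γ t)) (t : ℝ) :
    HasDerivAt (antiperiodicExtension γ T) (V (antiperiodicExtension γ T t)) t := by
  set η := antiperiodicExtension γ T
  have heta : Function.Antiperiodic η T := antiperiodicExtension_antiperiodic γ hT.ne'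
  have hIco : ∀ t ∈ Ico 0 T, η t = γ t := fun t ht =>
    antiperiodicExtension_of_mem_Icc hT hanti (Ico_subset_Icc_self ht)
  have hVodd : ∀ t, V (-η t) = -V (η t) := fun t => by
    have hper : Function.Periodic (fun t => V (-η t) = -V (η t)) T := fun t => by
      simp only [heta t, neg_neg, eq_iff_iff]
      exact ⟨fun h => by rw [h, neg_neg], fun h => by rw [h, neg_neg]⟩
    obtain ⟨s, hs, hts⟩ := hper.exists_mem_Ico₀ hT t
    exact hts.mpr (hIco s hs ▸ hodd s (Ico_subset_Icc_self hs))
  have hper : Function.Periodic (fun t => HasDerivAt η (V (η t)) t) T := fun t => by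
    refine propext ⟨fun h => ?_, fun h => ?_⟩
    · have hneg := (h.comp_add_const t T).fun_neg
      simpa only [heta _, hVodd, neg_neg] using hneg
    · have hneg := (HasDerivAt.comp_sub_const (t + T) T (by rwa [add_sub_cancel_right])).fun_neg
      simpa only [heta.sub_eq, heta t, hVodd, neg_neg] using hneg
  obtain ⟨s, hs, hts⟩ := hper.exists_mem_Ico₀ hT t
  exact hts.mpr (hIco s hs ▸ hasDerivAt_antiperiodicExtension_of_mem_Ico hT hγ hanti
    (hodd 0 (left_mem_Icc.2 hT.le)) hs)

end AntiperiodicExtension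

section OrbitOfArc

variable {f g X z : ℝ → ℝ} {d : EReal} {b p q Y : ℝ}

theorem OddSystem.lienardField_neg (H : OddSystem f g d) {P : ℝ × ℝ} (hP : P ∈ strip d) :
    lienardField f g (-P) = -lienardField f g P :=
  Prod.ext (by simp only [lienardField, Prod.fst_neg, Prod.snd_neg, H.F_odd _ hP]; ring)
    (by simp only [lienardField, Prod.fst_neg, Prod.snd_neg, H.g_odd _ hP])

theorem OddSystem.continuousOn_lienardField (H : OddSystem f g d) :
    ContinuousOn (lienardField f g) (strip d) :=
  (continuousOn_snd.sub (H.continuousOn_F.comp continuousOn_fst fun _ h => h)).prodMk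
    (H.g_cont.comp continuousOn_fst fun _ h => h).neg

theorem arcPoint_mem_strip (hb : b ∈ symInterval d) (hX : PotentialInverse g b X) (s : ℝ) :
    arcPoint X z s ∈ strip d := Icc_subset_symInterval hb (hX.mem (z s))

theorem arcPoint_of_eq_zero (hX : PotentialInverse g b X) {s : ℝ} (hs : z s = 0) :
    arcPoint X z s = (0, -s) := by
  rw [arcPoint, hs, hX.of_le 0 (primitive_zero g).ge]

theorem Arc.continuousOn_arcPoint (A : Arc (transform f X) p q z) (hX : PotentialInverse g b X) :
    ContinuousOn (arcPoint X z) (Icc p q) :=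
  (hX.cont.comp_continuousOn A.cont).prodMk continuousOn_neg

theorem Arc.hasDerivAt_fst_arcPoint (A : Arc (transform f X) p q z) (hX : PotentialInverse g b X)
    (hz : ∀ s ∈ Icc p q, z s < primitive g b) {s : ℝ} (hs : s ∈ Ioo p q) :
    HasDerivAt (fun s => X (z s)) ((g (X (z s)))⁻¹ * (transform f X (z s) - s)) s :=
  (hX.deriv _ ⟨(primitive_zero g).trans_lt (A.posIoo s hs),
    hz s (Ioo_subset_Icc_self hs)⟩).comp s (A.deriv s hs)

/-- The time parameter along an arc has derivative `1 / g` with respect to `s = -y`. It is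
integrable although `g` vanishes at both ends: there `dx/ds = (y - F x) / g` has the sign of `y`. -/
theorem Arc.exists_time_change (A : Arc (transform f X) p q z) (H : OddSystem f g d)
    (hb : b ∈ symInterval d) (hX : PotentialInverse g b X)
    (hz : ∀ s ∈ Icc p q, z s < primitive g b) :
    ∃ T > 0, ∃ S : ℝ → ℝ, Continuous S ∧ S '' Icc 0 T = Icc p q ∧ S 0 = p ∧ S T = q ∧
      ∀ t ∈ Ioo 0 T, S t ∈ Ioo p q ∧ HasDerivAt S (g (X (z (S t)))) t := by
  have hXsym : ∀ r, X r ∈ symInterval d := fun r => Icc_subset_symInterval hb (hX.mem r)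
  have hXz : ContinuousOn (fun s => X (z s)) (Icc p q) := hX.cont.comp_continuousOn A.cont
  have hg_pos : ∀ s ∈ Ioo p q, 0 < g (X (z s)) := fun s hs => by
    refine H.g_pos _ (hXsym _) (hX.mem_Ioo _ ⟨?_, hz s (Ioo_subset_Icc_self hs)⟩).1
    exact (primitive_zero g).trans_lt (A.posIoo s hs)
  have hζ : ∀ s ∈ Ioo p q, 0 < (g (X (z s)))⁻¹ := fun s hs => inv_pos.2 (hg_pos s hs)
  have hζc : ContinuousOn (fun s => (g (X (z s)))⁻¹) (Ioo p q) :=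
    ((H.g_cont.comp hXz fun s _ => hXsym _).mono Ioo_subset_Icc_self).inv₀
      fun s hs => (hg_pos s hs).ne'
  have hΨ := H.regular_transform hb hX
  have hint := integrableOn_of_hasDerivAt_mul_of_sign A.lt hXz
    (fun s => A.hasDerivAt_fst_arcPoint hX hz) hζ hζc
    ((hΨ.cont.comp_continuousOn A.cont).sub continuousOn_id)
    (by simpa [A.left, hΨ.zero] using A.neg) (by simpa [A.right, hΨ.zero] using A.pos)
  simpa only [inv_inv] using Lienard.exists_time_change A.lt hint hζ hζc

theorem Arc.exists_path (A : Arc (transform f X) p q z) (H : OddSystem f g d)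
    (hb : b ∈ symInterval d) (hX : PotentialInverse g b X)
    (hz : ∀ s ∈ Icc p q, z s < primitive g b) :
    ∃ T > 0, ∃ γ : ℝ → ℝ × ℝ,
      (∀ t ∈ Icc 0 T, HasDerivWithinAt γ (lienardField f g (γ t)) (Icc 0 T) t) ∧
      γ 0 = (0, -p) ∧ γ T = (0, -q) ∧ γ '' Icc 0 T = arcPoint X z '' Icc p q := by
  obtain ⟨T, hT, S, hSc, hSI, hS0, hST, hSd⟩ := A.exists_time_change H hb hX hz
  have hγc : ContinuousOn (fun t => arcPoint X z (S t)) (Icc 0 T) :=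
    (A.continuousOn_arcPoint hX).comp hSc.continuousOn (mapsTo_iff_image_subset.2 hSI.subset)
  refine ⟨T, hT, fun t => arcPoint X z (S t), fun t ht => ?_, ?_, ?_, ?_⟩
  · refine hasDerivWithinAt_Icc_of_Ioo (φ := fun t => lienardField f g (arcPoint X z (S t))) hT hγc
      (H.continuousOn_lienardField.comp hγc fun t _ => arcPoint_mem_strip hb hX _)
      (fun t ht => ?_) ht
    obtain ⟨hSt, hS'⟩ := hSd t ht
    have hg : g (X (z (S t))) ≠ 0 := fun h0 => by
      have hlt := hz _ (Ioo_subset_Icc_self hSt)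
      exact (H.g_pos _ (Icc_subset_symInterval hb (hX.mem _)) (hX.mem_Ioo _
        ⟨(primitive_zero g).trans_lt (A.posIoo _ hSt), hlt⟩).1).ne' h0
    refine (((A.hasDerivAt_fst_arcPoint hX hz hSt).comp t hS').prodMk hS'.neg).congr_deriv ?_
    refine Prod.ext ?_ rfl
    simp only [lienardField, arcPoint, transform]
    field_simp
    ring
  · simp only [hS0, arcPoint_of_eq_zero hX A.left]
  · simp only [hST, arcPoint_of_eq_zero hX A.right]
  · rw [← hSI, image_image]

/-- The centrally symmetric closed curve whose half `x ≥ 0` is described by the solution `z` of the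
transformed equation on `[-Y, Y]`. -/
def closedCurve (X z : ℝ → ℝ) (Y : ℝ) : Set (ℝ × ℝ) :=
  arcPoint X z '' Icc (-Y) Y ∪ -(arcPoint X z '' Icc (-Y) Y)

theorem Arc.isPeriodicOrbit_closedCurve (A : Arc (transform f X) (-Y) Y z) (H : OddSystem f g d)
    (hb : b ∈ symInterval d) (hX : PotentialInverse g b X)
    (hz : ∀ s ∈ Icc (-Y) Y, z s < primitive g b) :
    IsPeriodicOrbit (lienardField f g) (strip d) (closedCurve X z Y) := by
  obtain ⟨T, hT, γ, hγ, hγ0, hγT, himage⟩ := A.exists_path H hb hX hz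
  have hanti : γ T = -γ 0 := by rw [hγ0, hγT, neg_neg, Prod.neg_mk, neg_zero]
  have hrange : range (antiperiodicExtension γ T) = closedCurve X z Y := by
    rw [range_antiperiodicExtension hT hanti, himage, closedCurve]
  have hstrip : ∀ t ∈ Icc 0 T, γ t ∈ strip d := fun t ht => by
    obtain ⟨s, -, hs⟩ := himage.subset ⟨t, ht, rfl⟩
    exact hs ▸ arcPoint_mem_strip hb hX s
  refine ⟨antiperiodicExtension γ T, fun t => ⟨?_, hasDerivAt_antiperiodicExtension hT hγ hanti
    (fun t ht => H.lienardField_neg (hstrip t ht)) t⟩, ⟨2 * T, by positivity,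
    (antiperiodicExtension_antiperiodic γ hT.ne').periodic_two_mul⟩, ⟨0, T, ?_⟩, hrange.symm⟩
  · rcases hrange.subset ⟨t, rfl⟩ with ⟨s, -, hs⟩ | ⟨s, -, hs⟩
    · exact hs ▸ arcPoint_mem_strip hb hX s
    · rw [← neg_neg (antiperiodicExtension γ T t), ← hs]
      exact neg_mem_symInterval (arcPoint_mem_strip hb hX s)
  · rw [antiperiodicExtension_of_mem_Icc hT hanti (left_mem_Icc.2 hT.le),
      antiperiodicExtension_of_mem_Icc hT hanti (right_mem_Icc.2 hT.le), hγ0, hγT]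
    intro h
    linarith [A.pos, congrArg Prod.snd h]

end OrbitOfArc

theorem exists_gt_mem_symInterval {d : EReal} {x : ℝ} (hx : x ∈ symInterval d) :
    ∃ b ∈ symInterval d, x < b :=
  have hnhds : ∀ᶠ b in 𝓝[>] x, b ∈ symInterval d :=
    nhdsWithin_le_nhds ((isOpen_symInterval d).mem_nhds hx)
  (hnhds.and self_mem_nhdsWithin).exists

theorem mem_symInterval_iff_of_nonneg {d : EReal} {x : ℝ} (hx : 0 ≤ x) :
    x ∈ symInterval d ↔ (x : EReal) < d := by
  rw [symInterval, mem_ofPred_eq, abs_of_nonneg hx]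

section Concat

variable {E : Type*} [NormedAddCommGroup E] [NormedSpace ℝ E]

theorem hasDerivWithinAt_Icc_of_Icc_of_Icc {γ γ' : ℝ → E} {p m q : ℝ} (hm : m ∈ Icc p q)
    (hl : ∀ t ∈ Icc p m, HasDerivWithinAt γ (γ' t) (Icc p m) t)
    (hr : ∀ t ∈ Icc m q, HasDerivWithinAt γ (γ' t) (Icc m q) t) {t : ℝ} (ht : t ∈ Icc p q) :
    HasDerivWithinAt γ (γ' t) (Icc p q) t := by
  rw [← Icc_union_Icc_eq_Icc hm.1 hm.2]
  rcases lt_trichotomy t m with htm | rfl | hmt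
  · refine (hl t ⟨ht.1, htm.le⟩).mono_of_mem_nhdsWithin ?_
    filter_upwards [self_mem_nhdsWithin, nhdsWithin_le_nhds (Iio_mem_nhds htm)] with r hr hrm
    exact hr.elim id fun h => absurd h.1 (not_le.2 hrm)
  · exact (hl t (right_mem_Icc.2 hm.1)).union (hr t (left_mem_Icc.2 hm.2))
  · refine (hr t ⟨hmt.le, ht.2⟩).mono_of_mem_nhdsWithin ?_
    filter_upwards [self_mem_nhdsWithin, nhdsWithin_le_nhds (Ioi_mem_nhds hmt)] with r hr hmr
    exact hr.elim (fun h => absurd h.2 (not_le.2 hmr)) id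

theorem exists_concat {V : E → E} {γ₁ γ₂ : ℝ → E} {T₁ T₂ : ℝ} (hT₁ : 0 ≤ T₁) (hT₂ : 0 ≤ T₂)
    (hγ₁ : ∀ t ∈ Icc 0 T₁, HasDerivWithinAt γ₁ (V (γ₁ t)) (Icc 0 T₁) t)
    (hγ₂ : ∀ t ∈ Icc 0 T₂, HasDerivWithinAt γ₂ (V (γ₂ t)) (Icc 0 T₂) t) (heq : γ₁ T₁ = γ₂ 0) :
    ∃ γ : ℝ → E, (∀ t ∈ Icc (-T₁) T₂, HasDerivWithinAt γ (V (γ t)) (Icc (-T₁) T₂) t) ∧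
      (∀ t ∈ Icc (-T₁) 0, γ t = γ₁ (t + T₁)) ∧ ∀ t ∈ Icc 0 T₂, γ t = γ₂ t := by
  set γ : ℝ → E := fun t => if t ≤ 0 then γ₁ (t + T₁) else γ₂ t with hγ
  have hl : ∀ t ∈ Icc (-T₁) 0, γ t = γ₁ (t + T₁) := fun t ht => if_pos ht.2
  have hr : ∀ t ∈ Icc 0 T₂, γ t = γ₂ t := fun t ht => by
    rcases ht.1.eq_or_lt with rfl | h0
    · simp only [hγ, le_refl, if_true, zero_add, heq]
    · exact if_neg (not_le.2 h0)
  have hmaps : MapsTo (· + T₁) (Icc (-T₁) 0) (Icc 0 T₁) := fun t ht => by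
    constructor <;> linarith [ht.1, ht.2]
  have h0 : (0 : ℝ) ∈ Icc (-T₁) T₂ := ⟨neg_nonpos.2 hT₁, hT₂⟩
  refine ⟨γ, fun t ht => hasDerivWithinAt_Icc_of_Icc_of_Icc (γ' := fun t => V (γ t)) h0
    (fun t ht => ?_) (fun t ht => ?_) ht, hl, hr⟩
  · have hd := (hγ₁ _ (hmaps ht)).scomp t ((hasDerivAt_id t).add_const T₁).hasDerivWithinAt hmaps
    rw [hl t ht]
    simpa only [one_smul] using hd.congr hl (hl t ht)
  · rw [hr t ht]
    exact (hγ₂ t ht).congr hr (hr t ht)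

end Concat

theorem Arc.le_of_isFixedPt {Ψ z : ℝ → ℝ} {R p q m s : ℝ} (hΨ : Regular Ψ R) (A : Arc Ψ p q z)
    (hA : ∀ s ∈ Ioo p q, z s < R) (hm : m ∈ Icc p q) (hfix : Ψ (z m) = m) (hs : s ∈ Icc p q) :
    z s ≤ z m := by
  obtain ⟨n, -, hl, hr⟩ := A.exists_rise hΨ hA
  have hmn : m = n := by
    rcases lt_trichotomy m n with hlt | heq | hgt
    · exact absurd (hl.below m ⟨hm.1, hlt⟩) hfix.not_gt
    · exact heq
    · have hbelow := hr.below (-m) ⟨neg_le_neg hm.2, neg_lt_neg hgt⟩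
      rw [neg_neg, hfix] at hbelow
      exact absurd hbelow (lt_irrefl _)
  exact hmn ▸ hl.le_vertex hr hs

section Existence

variable {f g X : ℝ → ℝ} {d : EReal} {a α b yp ym : ℝ}

theorem IsUpperIntercept.pos (hp : IsUpperIntercept f g d α yp) : 0 < α := by
  obtain ⟨-, T, γ, ⟨hT, -⟩, -, hγT, hpos⟩ := hp
  have hfst := hpos T (right_mem_Ioc.2 hT)
  rwa [hγT] at hfst

theorem exists_halfOrbit_of_intercepts (hp : IsUpperIntercept f g d α yp)
    (hm : IsLowerIntercept f g d α ym) :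
    ∃ b ∈ symInterval d, ∃ t₀ t₁ γ, HalfOrbit f g b t₀ t₁ γ ∧ γ t₀ = (0, yp) ∧ γ t₁ = (0, ym) ∧
      curvePoint f α ∈ γ '' Icc t₀ t₁ := by
  obtain ⟨hyp, T₁, γ₁, ⟨hT₁, hγ₁⟩, hγ₁0, hγ₁T, hpos₁⟩ := hp
  obtain ⟨hym, T₂, γ₂, ⟨hT₂, hγ₂⟩, hγ₂0, hγ₂T, hpos₂⟩ := hm
  obtain ⟨γ, hderiv, hl, hr⟩ := exists_concat hT₁.le hT₂.le (fun t ht => (hγ₁ t ht).2)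
    (fun t ht => (hγ₂ t ht).2) (hγ₁T.trans hγ₂0.symm)
  have h0 : (0 : ℝ) ∈ Icc (-T₁) T₂ := ⟨neg_nonpos.2 hT₁.le, hT₂.le⟩
  have hstart : γ (-T₁) = (0, yp) := by
    rw [hl _ (left_mem_Icc.2 h0.1), neg_add_cancel, hγ₁0]
  have hfinish : γ T₂ = (0, ym) := by rw [hr _ (right_mem_Icc.2 h0.2), hγ₂T]
  obtain ⟨τ, hτ, hmax⟩ := isCompact_Icc.exists_isMaxOn ⟨0, h0⟩
    (continuous_fst.comp_continuousOn (HasDerivWithinAt.continuousOn hderiv))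
  have hmem : (γ τ).1 ∈ symInterval d := by
    rcases le_total τ 0 with h | h
    · exact hl τ ⟨hτ.1, h⟩ ▸ (hγ₁ _ ⟨by linarith [hτ.1], by linarith⟩).1
    · exact hr τ ⟨h, hτ.2⟩ ▸ (hγ₂ τ ⟨h, hτ.2⟩).1
  obtain ⟨b, hb, hτb⟩ := exists_gt_mem_symInterval hmem
  refine ⟨b, hb, -T₁, T₂, γ, ⟨by linarith, hderiv, by rw [hstart], by rw [hfinish],
    fun t ht => ?_, fun t ht => (hmax ht).trans_lt hτb, by rwa [hstart], by rwa [hfinish]⟩,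
    hstart, hfinish, 0, h0, (hr 0 (left_mem_Icc.2 h0.2)).trans hγ₂0⟩
  rcases le_total t 0 with h | h
  · exact hl t ⟨ht.1.le, h⟩ ▸ hpos₁ _ ⟨by linarith [ht.1], by linarith⟩
  · exact hr t ⟨h, ht.2.le⟩ ▸ hpos₂ t ⟨h, ht.2⟩

theorem OddSystem.exists_arc_of_intercepts (H : OddSystem f g d) (hp : IsUpperIntercept f g d α yp)
    (hm : IsLowerIntercept f g d α ym) :
    ∃ b ∈ symInterval d, α ≤ b ∧ ∃ X z, PotentialInverse g b X ∧
      Arc (transform f X) (-yp) (-ym) z ∧ (∀ s ∈ Icc (-yp) (-ym), z s ≤ primitive g α) ∧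
      primitive g α < primitive g b := by
  obtain ⟨b, hb, t₀, t₁, γ, O, hγ₀, hγ₁, t, ht, hQ⟩ := exists_halfOrbit_of_intercepts hp hm
  have hαb : α ∈ Icc 0 b := by
    have hmem := O.fst_mem ht
    rwa [hQ] at hmem
  obtain ⟨X, hX⟩ := H.exists_potentialInverse (hαb.1.trans hαb.2) hb
  obtain ⟨z, A, hz, himage⟩ := O.exists_arc H hb hX
  rw [hγ₀, hγ₁] at A hz himage
  obtain ⟨m, hm, hmQ⟩ := himage.subset ⟨t, ht, hQ⟩
  have hX_zm : X (z m) = α := congrArg Prod.fst hmQ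
  have hzm : z m = primitive g α := by
    rw [← hX_zm, hX.right_inv _ ⟨(primitive_zero g).trans_le (A.nonneg hm), (hz m hm).le⟩]
  have hfix : transform f X (z m) = m := by
    rw [transform, hX_zm, neg_eq_iff_eq_neg]
    exact (congrArg Prod.snd hmQ).symm
  exact ⟨b, hb, hαb.2, X, z, hX, A, fun s hs => hzm ▸ A.le_of_isFixedPt
    (H.regular_transform hb hX) (fun s hs => hz s (Ioo_subset_Icc_self hs)) hm hfix hs,
    hzm ▸ hz m hm⟩

/-- The sign conditions on `F`: it vanishes at `a`, is negative on `(0, a)` and nondecreasing on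
`[a, d)`. -/
structure SignCondition (f : ℝ → ℝ) (d : EReal) (a : ℝ) : Prop where
  pos : 0 < a
  mem : a ∈ symInterval d
  zero : primitive f a = 0
  neg : ∀ x ∈ Ioo 0 a, primitive f x < 0
  mono : MonotoneOn (primitive f) (symInterval d ∩ Ici a)

theorem SignCondition.nonpos (S : SignCondition f d a) {x : ℝ} (hx : x ∈ Icc 0 a) :
    primitive f x ≤ 0 := by
  rcases hx.1.eq_or_lt with rfl | h0
  · exact (primitive_zero f).le
  rcases hx.2.eq_or_lt with rfl | ha
  · exact S.zero.le
  · exact (S.neg x ⟨h0, ha⟩).le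

theorem SignCondition.exists_transform_nonneg (S : SignCondition f d a)
    (hX : PotentialInverse g b X) :
    ∃ r > 0, ∀ x ∈ Icc 0 r, 0 ≤ transform f X x := by
  have hX0 : X 0 < a := (hX.of_le 0 (primitive_zero g).ge).trans_lt S.pos
  obtain ⟨r, hr, hsub⟩ := mem_nhdsGE_iff_exists_Icc_subset.1
    (mem_nhdsWithin_of_mem_nhds (hX.cont.continuousAt.eventually_lt_const hX0))
  exact ⟨r, hr, fun x hx => neg_nonneg.2 (S.nonpos ⟨(hX.mem x).1, (hsub hx).le⟩)⟩

theorem OddSystem.abs_fst_le_of_mem_closedCurve (H : OddSystem f g d) (hb : b ∈ symInterval d)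
    (hX : PotentialInverse g b X) (hα : α ∈ Icc 0 b) {z : ℝ → ℝ} {Y : ℝ}
    (hz0 : ∀ s ∈ Icc (-Y) Y, 0 ≤ z s) (hz : ∀ s ∈ Icc (-Y) Y, z s ≤ primitive g α) {P : ℝ × ℝ}
    (hP : P ∈ closedCurve X z Y) : |P.1| ≤ α := by
  have hG := H.strictMonoOn_G hb
  have hX_le : ∀ s ∈ Icc (-Y) Y, |X (z s)| ≤ α := fun s hs => by
    rw [abs_of_nonneg (hX.mem _).1, ← hG.le_iff_le (hX.mem _) hα,
      hX.right_inv _ ⟨(primitive_zero g).trans_le (hz0 s hs), (hz s hs).trans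
        (hG.monotoneOn hα (right_mem_Icc.2 (hα.1.trans hα.2)) hα.2)⟩]
    exact hz s hs
  rcases hP with ⟨s, hs, hsP⟩ | ⟨s, hs, hsP⟩
  · exact hsP ▸ hX_le s hs
  · rw [← abs_neg, ← Prod.fst_neg, ← hsP]
    exact hX_le s hs

theorem OddSystem.exists_periodicOrbit (H : OddSystem f g d) (S : SignCondition f d a)
    (hp : IsUpperIntercept f g d α yp) (hm : IsLowerIntercept f g d α ym) (hle : -ym ≤ yp) :
    ∃ C, IsPeriodicOrbit (lienardField f g) (strip d) C ∧ ∀ P ∈ C, |P.1| ≤ α := by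
  obtain ⟨b, hb, hαb, X, z, hX, A, hz, hGα⟩ := H.exists_arc_of_intercepts hp hm
  have hGb := H.G_pos hb (hp.pos.trans_le hαb)
  have hΨ := H.continuous_transform hb hX
  obtain ⟨r, hr, hpos⟩ := S.exists_transform_nonneg hX
  obtain ⟨φ, hφ⟩ := exists_isLipschitzApprox hGb.le hΨ (transform_projIcc hX hGb.le)
  obtain ⟨Y, ζ, B, hζ⟩ := A.exists_symmetric hφ hΨ (fun x => transform_of_nonpos hX) hr
    hpos (by rwa [neg_neg]) hz
  exact ⟨closedCurve X ζ Y,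
    B.isPeriodicOrbit_closedCurve H hb hX fun s hs => (hζ s hs).trans_lt hGα,
    fun P hP => H.abs_fst_le_of_mem_closedCurve hb hX ⟨hp.pos.le, hαb⟩ (fun s => B.nonneg) hζ hP⟩

end Existence

section SignOfPrimitive

variable {f g : ℝ → ℝ} {d : EReal} {a α y : ℝ}

theorem monotoneOn_insert_of_mem_nhdsGT {φ : ℝ → ℝ} {s : Set ℝ} (hφ : MonotoneOn φ s)
    (hs : s ∈ 𝓝[>] a) (hcont : ContinuousAt φ a) : MonotoneOn φ (insert a s) :=
  hφ.insert_of_continuousWithinAt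
    (NeBot.mono (inferInstance : (𝓝[>] a).NeBot)
      (le_inf nhdsWithin_le_nhds (le_principal_iff.2 hs)))
    hcont.continuousWithinAt

theorem monotoneOn_inter_Ici_of_Ioc_of_Ioi {φ : ℝ → ℝ} {s : Set ℝ} (hs : IsOpen s) (ha : a ∈ s)
    (hα : α ∈ s) (hcont : ContinuousOn φ s) (hl : MonotoneOn φ (Ioc a α))
    (hr : MonotoneOn φ (s ∩ Ioi α)) : MonotoneOn φ (s ∩ Ici a) := by
  have hcontAt : ∀ c ∈ s, ContinuousAt φ c := fun c hc => hcont.continuousAt (hs.mem_nhds hc)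
  have hIoi : ∀ c ∈ s, s ∩ Ioi c ∈ 𝓝[>] c := fun c hc =>
    inter_mem (nhdsWithin_le_nhds (hs.mem_nhds hc)) self_mem_nhdsWithin
  have hIci : ∀ c ∈ s, insert c (s ∩ Ioi c) = s ∩ Ici c := fun c hc => by
    rw [insert_inter_distrib, Ioi_insert, insert_eq_of_mem hc]
  rcases le_or_gt α a with hαa | haα
  · exact hIci a ha ▸ monotoneOn_insert_of_mem_nhdsGT
      (hr.mono (inter_subset_inter_right s (Ioi_subset_Ioi hαa))) (hIoi a ha) (hcontAt a ha)
  have hIcc : MonotoneOn φ (Icc a α) := Ioc_insert_left haα.le ▸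
    monotoneOn_insert_of_mem_nhdsGT hl (Ioc_mem_nhdsGT haα) (hcontAt a ha)
  have hIciα : MonotoneOn φ (s ∩ Ici α) := hIci α hα ▸
    monotoneOn_insert_of_mem_nhdsGT hr (hIoi α hα) (hcontAt α hα)
  refine (hIcc.union_right hIciα (isGreatest_Icc haα.le) ⟨⟨hα, self_mem_Ici⟩, fun _ h => h.2⟩).mono
    fun x hx => ?_
  rcases le_total x α with h | h
  · exact Or.inl ⟨hx.2, h⟩
  · exact Or.inr ⟨hx.1, h⟩

theorem OddSystem.hasDerivWithinAt_energy (H : OddSystem f g d) {s : Set ℝ} {γ : ℝ → ℝ × ℝ} {t : ℝ}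
    (hstrip : γ t ∈ strip d) (hγ : HasDerivWithinAt γ (lienardField f g (γ t)) s t) :
    HasDerivWithinAt (fun t => energy g (γ t)) (-(primitive f (γ t).1 * g (γ t).1)) s t := by
  have hfst : HasDerivWithinAt (fun t => (γ t).1) ((γ t).2 - primitive f (γ t).1) s t := hγ.fst
  have hsnd : HasDerivWithinAt (fun t => (γ t).2) (-g (γ t).1) s t := hγ.snd
  refine (((H.hasDerivAt_G hstrip).comp_hasDerivWithinAt t hfst).add
    ((hsnd.pow 2).div_const 2)).congr_deriv ?_
  simp only [Nat.cast_ofNat, Nat.add_one_sub_one, pow_one]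
  ring

/-- Where `F ≥ 0` the energy decreases along orbits, strictly so while `0 < x < a`. -/
theorem OddSystem.exists_F_neg_of_isUpperRoot (H : OddSystem f g d) (ha : 0 < a)
    (hne : ∀ x ∈ Ioo 0 a, primitive f x ≠ 0) (hα : IsUpperRoot f g d α) :
    ∃ x ∈ symInterval d, 0 < x ∧ primitive f x < 0 := by
  obtain ⟨y, ⟨-, T, γ, ⟨hT, hγ⟩, hγ0, hγT, hpos⟩, hroot⟩ := hα
  by_contra! hF
  have h0 := left_mem_Icc.2 hT.le
  have hE : ∀ t ∈ Icc 0 T, HasDerivWithinAt (fun t => energy g (γ t))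
      (-(primitive f (γ t).1 * g (γ t).1)) (Icc 0 T) t :=
    fun t ht => H.hasDerivWithinAt_energy (hγ t ht).1 (hγ t ht).2
  have hanti : AntitoneOn (fun t => energy g (γ t)) (Icc 0 T) := by
    refine antitoneOn_of_hasDerivWithinAt_nonpos (convex_Icc 0 T)
      (HasDerivWithinAt.continuousOn hE) (fun t ht => (hE t (interior_subset ht)).mono
        interior_subset) fun t ht => ?_
    have hmem := (hγ t (interior_subset ht)).1
    rw [interior_Icc] at ht
    have hx := hpos t (Ioo_subset_Ioc_self ht)
    exact neg_nonpos.2 (mul_nonneg (hF _ hmem hx) (H.g_pos _ hmem hx).le)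
  have hends : energy g (γ 0) = energy g (γ T) := by
    rw [hγ0, hγT]
    simp only [energy, curvePoint, primitive_zero]
    linarith
  have hconst : ∀ t ∈ Icc 0 T, energy g (γ t) = energy g (γ 0) := fun t ht =>
    le_antisymm (hanti h0 ht ht.1) (hends ▸ hanti ht (right_mem_Icc.2 hT.le) ht.2)
  have hsmall : ∀ᶠ t in 𝓝[>] 0, (γ t).1 < a := by
    have hcont : ContinuousWithinAt (fun t => (γ t).1) (Icc 0 T) 0 :=
      (hγ 0 h0).2.continuousWithinAt.fst
    have hlim := (hcont.mono Ioo_subset_Icc_self).tendsto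
    rw [nhdsWithin_Ioo_eq_nhdsGT hT, hγ0] at hlim
    exact hlim.eventually_lt_const ha
  obtain ⟨t, hta, ht⟩ := (hsmall.and (Ioo_mem_nhdsGT hT)).exists
  have hx := hpos t (Ioo_subset_Ioc_self ht)
  have hmem := (hγ t (Ioo_subset_Icc_self ht)).1
  have hnhds := Icc_mem_nhds ht.1 ht.2
  have hzero := ((hE t (Ioo_subset_Icc_self ht)).hasDerivAt hnhds).unique
    ((hasDerivAt_const t (energy g (γ 0))).congr_of_eventuallyEq (mem_of_superset hnhds hconst))
  exact mul_ne_zero (hne _ ⟨hx, hta⟩) (H.g_pos _ hmem hx).ne' (neg_eq_zero.1 hzero)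

theorem OddSystem.signCondition (H : OddSystem f g d) (ha : 0 < a) (had : a ∈ symInterval d)
    (hFa : primitive f a = 0) (hne : ∀ x ∈ Ioo 0 a, primitive f x ≠ 0)
    (hα : IsUpperRoot f g d α) (hmono : MonotoneOn (primitive f) (symInterval d ∩ Ici a)) :
    SignCondition f d a where
  pos := ha
  mem := had
  zero := hFa
  mono := hmono
  neg x hx := by
    obtain ⟨y, hyd, hy0, hFy⟩ := H.exists_F_neg_of_isUpperRoot ha hne hα
    have hya : y < a := by
      by_contra! hay
      exact hFy.not_ge (hFa ▸ hmono ⟨had, self_mem_Ici⟩ ⟨hyd, hay⟩ hay)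
    by_contra! hFx
    obtain ⟨w, hw, hFw⟩ := isPreconnected_Ioo.intermediate_value ⟨hy0, hya⟩ hx
      (H.continuousOn_F.mono (Ioo_subset_Icc_self.trans (Icc_subset_symInterval had)))
      ⟨hFy.le, hFx⟩
    exact hne w hw hFw

end SignOfPrimitive

section FirstZero

variable {x : ℝ → ℝ} {x' t t' : ℝ}

theorem exists_first_zero (hx : Continuous x) (htt' : t ≤ t') (ht : 0 < x t) (ht' : x t' ≤ 0) :
    ∃ t₁ > t, x t₁ = 0 ∧ ∀ s ∈ Ico t t₁, 0 < x s := by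
  obtain ⟨t₁, ⟨h₁, hx₁⟩, hleast⟩ :=
    (isCompact_Icc.inter_right (isClosed_le hx continuous_const)).exists_isLeast
      (⟨t', ⟨htt', le_rfl⟩, ht'⟩ : (Icc t t' ∩ {s | x s ≤ 0}).Nonempty)
  have hpos : ∀ s ∈ Ico t t₁, 0 < x s := fun s hs =>
    not_le.1 fun h => hs.2.not_ge (hleast ⟨⟨hs.1, hs.2.le.trans h₁.2⟩, h⟩)
  have hlt : t < t₁ := h₁.1.lt_of_ne fun h => (h ▸ ht).not_ge hx₁
  refine ⟨t₁, hlt, le_antisymm hx₁ ?_, hpos⟩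
  refine ge_of_tendsto (hx.tendsto t₁ |>.mono_left (nhdsWithin_le_nhds (s := Iio t₁))) ?_
  filter_upwards [Ico_mem_nhdsLT hlt] with s hs using (hpos s hs).le

theorem exists_last_zero (hx : Continuous x) (htt' : t' ≤ t) (ht : 0 < x t) (ht' : x t' ≤ 0) :
    ∃ t₀ < t, x t₀ = 0 ∧ ∀ s ∈ Ioc t₀ t, 0 < x s := by
  obtain ⟨r, hr, hxr, hpos⟩ := exists_first_zero (hx.comp continuous_neg) (neg_le_neg htt')
    (by simpa using ht) (by simpa using ht')
  refine ⟨-r, neg_lt.1 hr, hxr, fun s hs => ?_⟩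
  simpa using hpos (-s) ⟨neg_le_neg hs.2, neg_lt.1 hs.1⟩

theorem eventually_nhdsGT_pos_of_hasDerivAt (h : HasDerivAt x x' t) (h0 : x t = 0)
    (hx' : 0 < x') : ∀ᶠ s in 𝓝[>] t, 0 < x s := by
  filter_upwards [nhdsGT_le_nhdsNE t (h.tendsto_slope.eventually_const_lt hx'),
    self_mem_nhdsWithin] with s hslope hs using pos_of_slope_pos hs hslope h0

theorem eventually_nhdsLT_neg_of_hasDerivAt (h : HasDerivAt x x' t) (h0 : x t = 0)
    (hx' : 0 < x') : ∀ᶠ s in 𝓝[<] t, x s < 0 := by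
  filter_upwards [nhdsLT_le_nhdsNE t (h.tendsto_slope.eventually_const_lt hx'),
    self_mem_nhdsWithin] with s hslope hs using neg_of_slope_pos hs hslope h0

end FirstZero

section Energy

variable {f g : ℝ → ℝ} {d : EReal} {a : ℝ}

theorem OddSystem.F_mul_g_nonpos (H : OddSystem f g d) (S : SignCondition f d a) {x : ℝ}
    (hx : |x| ≤ a) :
    primitive f x * g x ≤ 0 := by
  wlog h : 0 ≤ x generalizing x
  · have hxd : x ∈ symInterval d := mem_symInterval_of_abs_le S.mem (hx.trans (le_abs_self a))
    have := this (x := -x) (by rwa [abs_neg]) (by linarith)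
    rwa [H.F_odd x hxd, H.g_odd x hxd, neg_mul_neg] at this
  rcases h.eq_or_lt with rfl | h
  · simp
  · rw [abs_of_pos h] at hx
    exact mul_nonpos_of_nonpos_of_nonneg (S.nonpos ⟨h.le, hx⟩)
      (H.g_pos x (Icc_subset_symInterval S.mem ⟨h.le, hx⟩) h).le

theorem OddSystem.G_pos_of_ne (H : OddSystem f g d) {x : ℝ} (hx : x ∈ symInterval d) (h0 : x ≠ 0) :
    0 < primitive g x := by
  rcases h0.lt_or_gt with h | h
  · rw [← primitive_neg_of_odd H.g_odd hx]
    exact H.G_pos (neg_mem_symInterval hx) (neg_pos.2 h)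
  · exact H.G_pos hx h

theorem OddSystem.eq_zero_of_energy_nonpos (H : OddSystem f g d) {P : ℝ × ℝ} (hP : P ∈ strip d)
    (h : energy g P ≤ 0) : P = 0 := by
  rw [energy] at h
  have hx : P.1 = 0 := by
    by_contra hne
    linarith [H.G_pos_of_ne hP hne, sq_nonneg P.2]
  rw [hx, primitive_zero] at h
  exact Prod.ext hx (pow_eq_zero_iff two_ne_zero |>.1 (by linarith [sq_nonneg P.2]))

end Energy

/-- `γ` is a nonconstant solution of the Liénard system of period `T` with `|x| < b`. -/
structure PeriodicSolution (f g : ℝ → ℝ) (b T : ℝ) (γ : ℝ → ℝ × ℝ) : Prop where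
  pos : 0 < T
  abs_lt : ∀ t, |(γ t).1| < b
  deriv : ∀ t, HasDerivAt γ (lienardField f g (γ t)) t
  periodic : Function.Periodic γ T
  nonconst : ∃ s t, γ s ≠ γ t

namespace PeriodicSolution

variable {f g X : ℝ → ℝ} {d : EReal} {a b T t : ℝ} {γ : ℝ → ℝ × ℝ}

theorem mono (P : PeriodicSolution f g b T γ) {b' : ℝ} (h : b ≤ b') :
    PeriodicSolution f g b' T γ :=
  { P with abs_lt := fun t => (P.abs_lt t).trans_le h }

theorem bound_pos (P : PeriodicSolution f g b T γ) : 0 < b := (abs_nonneg _).trans_lt (P.abs_lt 0)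

theorem mem_strip (P : PeriodicSolution f g b T γ) (hb : b ∈ symInterval d) (t : ℝ) :
    γ t ∈ strip d :=
  mem_symInterval_of_abs_le hb ((P.abs_lt t).le.trans (le_abs_self b))

theorem neg (P : PeriodicSolution f g b T γ) (H : OddSystem f g d) (hb : b ∈ symInterval d) :
    PeriodicSolution f g b T (-γ) where
  pos := P.pos
  abs_lt t := (abs_neg _).trans_lt (P.abs_lt t)
  deriv t := H.lienardField_neg (P.mem_strip hb t) ▸ (P.deriv t).neg
  periodic t := congrArg Neg.neg (P.periodic t)
  nonconst := P.nonconst.imp fun _ => Exists.imp fun _ => neg_injective.ne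

theorem continuous (P : PeriodicSolution f g b T γ) : Continuous γ :=
  continuous_iff_continuousAt.2 fun t => (P.deriv t).continuousAt

theorem hasDerivAt_fst (P : PeriodicSolution f g b T γ) (t : ℝ) :
    HasDerivAt (fun t => (γ t).1) ((γ t).2 - primitive f (γ t).1) t := (P.deriv t).fst

theorem hasDerivAt_fst_of_fst_eq_zero (P : PeriodicSolution f g b T γ) (h : (γ t).1 = 0) :
    HasDerivAt (fun t => (γ t).1) (γ t).2 t := by
  simpa only [h, primitive_zero, sub_zero] using P.hasDerivAt_fst t

theorem hasDerivAt_snd (P : PeriodicSolution f g b T γ) (t : ℝ) :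
    HasDerivAt (fun t => (γ t).2) (-g (γ t).1) t := (P.deriv t).snd

/-- As `F` and `x` have opposite signs near `0`, the energy does not decrease along orbits there. -/
theorem eventually_eq_zero (P : PeriodicSolution f g b T γ) (H : OddSystem f g d)
    (S : SignCondition f d a) (hb : b ∈ symInterval d) (ht : γ t = 0) :
    ∀ᶠ s in 𝓝[<] t, γ s = 0 := by
  have hnear : ∀ᶠ s in 𝓝[<] t, |(γ s).1| < a :=
    nhdsWithin_le_nhds ((continuous_fst.comp P.continuous).abs.continuousAt.eventually_lt_const
      (by simpa [ht] using S.pos))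
  obtain ⟨c, hc, hsub⟩ := mem_nhdsLT_iff_exists_Ico_subset.1 hnear
  have hE : ∀ s, HasDerivWithinAt (fun s => energy g (γ s)) (-(primitive f (γ s).1 * g (γ s).1))
      univ s := fun s =>
    H.hasDerivWithinAt_energy (P.mem_strip hb s) (P.deriv s).hasDerivWithinAt
  have hmono : MonotoneOn (fun s => energy g (γ s)) (Icc c t) := by
    refine monotoneOn_of_hasDerivWithinAt_nonneg (convex_Icc c t)
      (fun s _ => (hE s).continuousWithinAt.mono (subset_univ _))
      (fun s _ => (hE s).mono (subset_univ _)) fun s hs => ?_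
    rw [interior_Icc] at hs
    exact neg_nonneg.2 (H.F_mul_g_nonpos S (hsub (Ioo_subset_Ico_self hs)).le)
  filter_upwards [Ico_mem_nhdsLT hc] with s hs
  refine H.eq_zero_of_energy_nonpos (P.mem_strip hb s) ?_
  simpa [energy, ht] using hmono (Ico_subset_Icc_self hs) (right_mem_Icc.2 (mem_Iio.1 hc).le)
    hs.2.le

theorem ne_zero (P : PeriodicSolution f g b T γ) (H : OddSystem f g d) (S : SignCondition f d a)
    (hb : b ∈ symInterval d) (t : ℝ) : γ t ≠ 0 := by
  intro ht
  have hall : Icc (t - T) t ⊆ {s | γ s = 0} := by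
    refine IsClosed.Icc_subset_of_forall_exists_lt
      ((isClosed_eq P.continuous continuous_const).inter isClosed_Icc) ht fun s hs r hr => ?_
    obtain ⟨s', hs', hrs'⟩ := ((P.eventually_eq_zero H S hb hs.1).and (Ico_mem_nhdsLT hr)).exists
    exact ⟨s', hs', hrs'⟩
  have hzero : ∀ s, γ s = 0 := fun s => by
    obtain ⟨r, hr, hsr⟩ := P.periodic.exists_mem_Ico P.pos s (t - T)
    exact hsr.trans (hall ⟨hr.1, by linarith [hr.2]⟩)
  obtain ⟨s, r, hne⟩ := P.nonconst
  exact hne ((hzero s).trans (hzero r).symm)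

theorem snd_ne_zero (P : PeriodicSolution f g b T γ) (H : OddSystem f g d) (S : SignCondition f d a)
    (hb : b ∈ symInterval d) (h : (γ t).1 = 0) : (γ t).2 ≠ 0 :=
  fun h' => P.ne_zero H S hb t (Prod.ext h h')

theorem exists_fst_nonpos (P : PeriodicSolution f g b T γ) (H : OddSystem f g d)
    (hb : b ∈ symInterval d) : ∃ t, (γ t).1 ≤ 0 := by
  by_contra! hpos
  have hanti : StrictAnti fun t => (γ t).2 := strictAnti_of_hasDerivAt_neg P.hasDerivAt_snd
    fun t => neg_lt_zero.2 (H.g_pos _ (P.mem_strip hb t) (hpos t))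
  exact (hanti P.pos).ne (congrArg Prod.snd P.periodic.eq)

theorem halfOrbit (P : PeriodicSolution f g b T γ) (H : OddSystem f g d) (S : SignCondition f d a)
    (hb : b ∈ symInterval d) {t₀ t₁ : ℝ} (hlt : t₀ < t₁) (h₀ : (γ t₀).1 = 0) (h₁ : (γ t₁).1 = 0)
    (hpos : ∀ t ∈ Ioo t₀ t₁, 0 < (γ t).1) : HalfOrbit f g b t₀ t₁ γ where
  lt := hlt
  deriv t _ := (P.deriv t).hasDerivWithinAt
  start_fst := h₀
  finish_fst := h₁
  fst_pos := hpos
  fst_lt t _ := (le_abs_self _).trans_lt (P.abs_lt t)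
  start_snd := by
    by_contra! hle
    have hneg := eventually_nhdsGT_pos_of_hasDerivAt (P.hasDerivAt_fst_of_fst_eq_zero h₀).neg
      (by simp [h₀]) (neg_pos.2 (hle.lt_of_ne (P.snd_ne_zero H S hb h₀)))
    obtain ⟨s, hs, hs'⟩ := (hneg.and (Ioo_mem_nhdsGT hlt)).exists
    exact (neg_pos.1 hs).not_gt (hpos s hs')
  finish_snd := by
    by_contra! hle
    have hneg := eventually_nhdsLT_neg_of_hasDerivAt (P.hasDerivAt_fst_of_fst_eq_zero h₁) h₁
      (hle.lt_of_ne (P.snd_ne_zero H S hb h₁).symm)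
    obtain ⟨s, hs, hs'⟩ := (hneg.and (Ioo_mem_nhdsLT hlt)).exists
    exact hs.not_gt (hpos s hs')

theorem exists_next_zero (P : PeriodicSolution f g b T γ) (H : OddSystem f g d)
    (hb : b ∈ symInterval d) (ht : 0 < (γ t).1) :
    ∃ t₁ > t, (γ t₁).1 = 0 ∧ ∀ s ∈ Ico t t₁, 0 < (γ s).1 := by
  obtain ⟨r, hr⟩ := P.exists_fst_nonpos H hb
  obtain ⟨s, hs, hrs⟩ := P.periodic.exists_mem_Ico P.pos r t
  exact exists_first_zero (continuous_fst.comp P.continuous) hs.1 ht (hrs ▸ hr)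

theorem exists_previous_zero (P : PeriodicSolution f g b T γ) (H : OddSystem f g d)
    (hb : b ∈ symInterval d) (ht : 0 < (γ t).1) :
    ∃ t₀ < t, (γ t₀).1 = 0 ∧ ∀ s ∈ Ioc t₀ t, 0 < (γ s).1 := by
  obtain ⟨r, hr⟩ := P.exists_fst_nonpos H hb
  obtain ⟨s, hs, hrs⟩ := P.periodic.exists_mem_Ico P.pos r (t - T)
  exact exists_last_zero (continuous_fst.comp P.continuous) (by linarith [hs.2]) ht (hrs ▸ hr)

theorem exists_halfOrbit_of_fst_pos (P : PeriodicSolution f g b T γ) (H : OddSystem f g d)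
    (S : SignCondition f d a) (hb : b ∈ symInterval d) (ht : 0 < (γ t).1) :
    ∃ t₀ t₁, HalfOrbit f g b t₀ t₁ γ ∧ t ∈ Icc t₀ t₁ := by
  obtain ⟨t₀, ht₀, h₀, hpos₀⟩ := P.exists_previous_zero H hb ht
  obtain ⟨t₁, ht₁, h₁, hpos₁⟩ := P.exists_next_zero H hb ht
  refine ⟨t₀, t₁, P.halfOrbit H S hb (ht₀.trans ht₁) h₀ h₁ fun s hs => ?_, ht₀.le, ht₁.le⟩
  rcases le_total s t with h | h
  · exact hpos₀ s ⟨hs.1, h⟩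
  · exact hpos₁ s ⟨h, hs.2⟩

theorem exists_halfOrbit_from (P : PeriodicSolution f g b T γ) (H : OddSystem f g d)
    (S : SignCondition f d a) (hb : b ∈ symInterval d) (h0 : (γ t).1 = 0) (hy : 0 < (γ t).2) :
    ∃ t₁, HalfOrbit f g b t t₁ γ := by
  obtain ⟨r, hr, hsub⟩ := mem_nhdsGT_iff_exists_Ioc_subset.1
    (eventually_nhdsGT_pos_of_hasDerivAt (P.hasDerivAt_fst_of_fst_eq_zero h0) h0 hy)
  obtain ⟨t₁, ht₁, h₁, hpos⟩ := P.exists_next_zero H hb (hsub (right_mem_Ioc.2 hr))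
  refine ⟨t₁, P.halfOrbit H S hb (mem_Ioi.1 hr |>.trans ht₁) h0 h₁ fun s hs => ?_⟩
  rcases le_total s r with h | h
  · exact hsub ⟨hs.1, h⟩
  · exact hpos s ⟨h, hs.2⟩

theorem exists_halfOrbit_to (P : PeriodicSolution f g b T γ) (H : OddSystem f g d)
    (S : SignCondition f d a) (hb : b ∈ symInterval d) (h1 : (γ t).1 = 0) (hy : (γ t).2 < 0) :
    ∃ t₀, HalfOrbit f g b t₀ t γ := by
  obtain ⟨r, hr, hsub⟩ := mem_nhdsLT_iff_exists_Ico_subset.1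
    (eventually_nhdsLT_neg_of_hasDerivAt (P.hasDerivAt_fst_of_fst_eq_zero h1).neg
      (by simp [h1]) (neg_pos.2 hy))
  obtain ⟨t₀, ht₀, h₀, hpos⟩ := P.exists_previous_zero H hb
    (neg_neg_iff_pos.1 (hsub (left_mem_Ico.2 hr)))
  refine ⟨t₀, P.halfOrbit H S hb (ht₀.trans hr) h₀ h1 fun s hs => ?_⟩
  rcases le_total s r with h | h
  · exact hpos s ⟨hs.1, h⟩
  · exact neg_neg_iff_pos.1 (hsub ⟨h, hs.2⟩)

theorem exists_halfOrbit_mem (P : PeriodicSolution f g b T γ) (H : OddSystem f g d)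
    (S : SignCondition f d a) (hb : b ∈ symInterval d) (t : ℝ) :
    (∃ t₀ t₁, HalfOrbit f g b t₀ t₁ γ ∧ t ∈ Icc t₀ t₁) ∨
      ∃ t₀ t₁, HalfOrbit f g b t₀ t₁ (-γ) ∧ t ∈ Icc t₀ t₁ := by
  rcases lt_trichotomy (γ t).1 0 with h | h | h
  · exact Or.inr ((P.neg H hb).exists_halfOrbit_of_fst_pos H S hb (neg_pos.2 h))
  · rcases (P.snd_ne_zero H S hb h).lt_or_gt with hy | hy
    · obtain ⟨t₀, O⟩ := P.exists_halfOrbit_to H S hb h hy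
      exact Or.inl ⟨t₀, t, O, right_mem_Icc.2 O.lt.le⟩
    · obtain ⟨t₁, O⟩ := P.exists_halfOrbit_from H S hb h hy
      exact Or.inl ⟨t, t₁, O, left_mem_Icc.2 O.lt.le⟩
  · exact Or.inl (P.exists_halfOrbit_of_fst_pos H S hb h)

theorem exists_fst_eq_zero (P : PeriodicSolution f g b T γ) (H : OddSystem f g d)
    (S : SignCondition f d a) (hb : b ∈ symInterval d) :
    ∃ t, (γ t).1 = 0 := by
  rcases P.exists_halfOrbit_mem H S hb 0 with ⟨t₀, _, O, _⟩ | ⟨t₀, _, O, _⟩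
  · exact ⟨t₀, O.start_fst⟩
  · exact ⟨t₀, neg_eq_zero.1 O.start_fst⟩

theorem exists_halfOrbit (P : PeriodicSolution f g b T γ) (H : OddSystem f g d)
    (S : SignCondition f d a) (hb : b ∈ symInterval d) :
    ∃ t₀ t₁, HalfOrbit f g b t₀ t₁ γ := by
  obtain ⟨t, ht⟩ := P.exists_fst_eq_zero H S hb
  rcases (P.snd_ne_zero H S hb ht).lt_or_gt with hy | hy
  · obtain ⟨t₀, O⟩ := P.exists_halfOrbit_to H S hb ht hy
    exact ⟨t₀, t, O⟩
  · exact ⟨t, P.exists_halfOrbit_from H S hb ht hy⟩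

end PeriodicSolution

section SymmetricArc

variable {f g X z z' : ℝ → ℝ} {d : EReal} {a b Y Y' : ℝ}

/-- Orbits cannot cross, so an arc that starts further out also ends further out. -/
theorem Arc.eq_neg_of_extremal {Ψ : ℝ → ℝ} {R p q : ℝ} (hΨ : Regular Ψ R) (A : Arc Ψ (-Y) q z)
    (hA : ∀ s ∈ Ioo (-Y) q, z s < R) (B : Arc Ψ p Y z') (hB : ∀ s ∈ Ioo p Y, z' s < R)
    (hext : q ≤ Y ∧ -Y ≤ p ∨ Y ≤ q ∧ p ≤ -Y) : p = -Y := by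
  rcases hext with ⟨hq, hp⟩ | ⟨hq, hp⟩
  · exact hp.antisymm' (not_lt.1 fun h => hq.not_gt (B.lt_of_lt hΨ hB A hA h).1)
  · exact hp.antisymm (not_lt.1 fun h => hq.not_gt (A.lt_of_lt hΨ hA B hB h).1)

theorem OddSystem.potentialInverse_lt_iff (H : OddSystem f g d) (hb : b ∈ symInterval d)
    (hX : PotentialInverse g b X) {c r : ℝ} (hc : c ∈ Icc 0 b) (hr : r ∈ Icc 0 (primitive g b)) :
    X r < c ↔ r < primitive g c := by
  rw [← (H.strictMonoOn_G hb).lt_iff_lt (hX.mem r) hc,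
    hX.right_inv r ⟨(primitive_zero g).trans_le hr.1, hr.2⟩]

theorem OddSystem.symmetric_arc_unique (H : OddSystem f g d) (S : SignCondition f d a)
    (hb : b ∈ symInterval d) (hb0 : 0 < b) (hX : PotentialInverse g b X)
    (A : Arc (transform f X) (-Y) Y z) (hA : ∀ s ∈ Icc (-Y) Y, z s < primitive g b)
    (B : Arc (transform f X) (-Y') Y' z') (hB : ∀ s ∈ Icc (-Y') Y', z' s < primitive g b) :
    Y = Y' ∧ EqOn z z' (Icc (-Y) Y) := by
  have hG := H.strictMonoOn_G hb
  have hc0 : 0 < min a b := lt_min S.pos hb0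
  have hc : min a b ∈ Icc 0 b := ⟨hc0.le, min_le_right a b⟩
  have hGc : primitive g (min a b) ≤ primitive g b :=
    hG.monotoneOn hc (right_mem_Icc.2 hb0.le) hc.2
  have hGc0 : 0 < primitive g (min a b) := H.G_pos (Icc_subset_symInterval hb hc) hc0
  have hXsym : ∀ r, X r ∈ symInterval d := fun r => Icc_subset_symInterval hb (hX.mem r)
  have hlow : ∀ r ∈ Ico (primitive g (min a b)) (primitive g b), a ≤ X r := fun r hr => by
    have hmin : min a b ≤ X r := not_lt.1 fun h =>
      hr.1.not_gt ((H.potentialInverse_lt_iff hb hX hc ⟨hGc0.le.trans hr.1, hr.2.le⟩).1 h)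
    rcases min_choice a b with h | h
    · exact h ▸ hmin
    · exact absurd (hr.1.trans_lt hr.2) (by rw [h]; exact lt_irrefl _)
  refine A.symmetric_unique (H.regular_transform hb hX) hGc0 (fun r hr => ?_) (fun r hr => ?_)
    (fun r hr r' hr' hle => ?_) (fun s hs => hA s (Ioo_subset_Icc_self hs)) B
    fun s hs => hB s (Ioo_subset_Icc_self hs)
  · have hrb : r < primitive g b := hr.2.trans_le hGc
    have hXc := (H.potentialInverse_lt_iff hb hX hc ⟨hr.1.le, hrb.le⟩).2 hr.2
    exact neg_pos.2 (S.neg _ ⟨(hX.mem_Ioo r ⟨(primitive_zero g).trans_lt hr.1, hrb⟩).1,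
      hXc.trans_le (min_le_left a b)⟩)
  · exact neg_nonpos.2 (S.zero ▸ S.mono ⟨S.mem, self_mem_Ici⟩ ⟨hXsym r, hlow r hr⟩ (hlow r hr))
  · refine neg_le_neg (S.mono ⟨hXsym r, hlow r hr⟩ ⟨hXsym r', hlow r' hr'⟩ ?_)
    have hmem : ∀ r ∈ Ico (primitive g (min a b)) (primitive g b),
        r ∈ Icc (primitive g 0) (primitive g b) := fun r hr =>
      ⟨(primitive_zero g).trans_le (hGc0.le.trans hr.1), hr.2.le⟩
    rwa [← hG.le_iff_le (hX.mem r) (hX.mem r'), hX.right_inv r (hmem r hr),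
      hX.right_inv r' (hmem r' hr')]

end SymmetricArc

section Uniqueness

variable {f g X z : ℝ → ℝ} {d : EReal} {a b t T t₀ t₁ Y : ℝ} {γ : ℝ → ℝ × ℝ}

theorem PeriodicSolution.exists_symmetric_arc (P : PeriodicSolution f g b T γ) (H : OddSystem f g d)
    (S : SignCondition f d a) (hb : b ∈ symInterval d) (hX : PotentialInverse g b X)
    (h0 : (γ t).1 = 0) (hext : (∀ r, (γ r).1 = 0 → |(γ r).2| ≤ |(γ t).2|) ∨
      ∀ r, (γ r).1 = 0 → |(γ t).2| ≤ |(γ r).2|) :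
    ∃ z, Arc (transform f X) (-|(γ t).2|) |(γ t).2| z ∧
      ∀ s ∈ Icc (-|(γ t).2|) |(γ t).2|, z s < primitive g b := by
  wlog hy : 0 < (γ t).2 generalizing γ
  · have hy' : (γ t).2 < 0 := (not_lt.1 hy).lt_of_ne (P.snd_ne_zero H S hb h0)
    simpa using this (P.neg H hb) (by simpa using h0) (by simpa using hext) (by simpa using hy')
  obtain ⟨t₁, O₁⟩ := P.exists_halfOrbit_from H S hb h0 hy
  obtain ⟨t₀, O₀⟩ := (P.neg H hb).exists_halfOrbit_to H S hb (t := t) (by simpa using h0)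
    (by simpa using hy)
  obtain ⟨z₁, A₁, hz₁, -⟩ := O₁.exists_arc H hb hX
  obtain ⟨z₀, A₀, hz₀, -⟩ := O₀.exists_arc H hb hX
  simp only [Pi.neg_apply, Prod.snd_neg, neg_neg] at A₀ hz₀
  have hy₀ : |(γ t₀).2| = -(γ t₀).2 := abs_of_neg A₀.neg
  have hy₁ : |(γ t₁).2| = -(γ t₁).2 := abs_of_neg O₁.finish_snd
  rw [abs_of_pos hy] at hext ⊢
  have hsymm : (γ t₀).2 = -(γ t).2 := by
    refine A₁.eq_neg_of_extremal (H.regular_transform hb hX)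
      (fun s hs => hz₁ s (Ioo_subset_Icc_self hs)) A₀
      (fun s hs => hz₀ s (Ioo_subset_Icc_self hs)) (hext.imp (fun h => ?_) fun h => ?_)
    all_goals
      have h₀ := h t₀ (neg_eq_zero.1 O₀.start_fst)
      have h₁ := h t₁ O₁.finish_fst
      rw [hy₀] at h₀
      rw [hy₁] at h₁
      constructor <;> linarith
  rw [hsymm] at A₀ hz₀
  exact ⟨z₀, A₀, hz₀⟩

/-- The outermost and the innermost crossing of the `y`-axis both carry a symmetric arc, and there
is only one symmetric arc. -/
theorem PeriodicSolution.exists_arc (P : PeriodicSolution f g b T γ) (H : OddSystem f g d)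
    (S : SignCondition f d a) (hb : b ∈ symInterval d) (hX : PotentialInverse g b X) :
    ∃ Y z, Arc (transform f X) (-Y) Y z ∧ (∀ s ∈ Icc (-Y) Y, z s < primitive g b) ∧
      ∀ t, (γ t).1 = 0 → |(γ t).2| = Y := by
  have hK : IsCompact (range γ ∩ {Q | Q.1 = 0}) :=
    (P.periodic.compact_of_continuous P.pos.ne' P.continuous).inter_right
      (isClosed_eq continuous_fst continuous_const)
  obtain ⟨t, ht⟩ := P.exists_fst_eq_zero H S hb
  have hne : (range γ ∩ {Q | Q.1 = 0}).Nonempty := ⟨γ t, mem_range_self t, ht⟩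
  have hcont : ContinuousOn (fun Q : ℝ × ℝ => |Q.2|) (range γ ∩ {Q | Q.1 = 0}) :=
    continuous_snd.abs.continuousOn
  obtain ⟨_, ⟨⟨tM, rfl⟩, htM⟩, hmax⟩ := hK.exists_isMaxOn hne hcont
  obtain ⟨_, ⟨⟨tm, rfl⟩, htm⟩, hmin⟩ := hK.exists_isMinOn hne hcont
  have hmax' : ∀ r, (γ r).1 = 0 → |(γ r).2| ≤ |(γ tM).2| := fun r hr => hmax ⟨⟨r, rfl⟩, hr⟩
  have hmin' : ∀ r, (γ r).1 = 0 → |(γ tm).2| ≤ |(γ r).2| := fun r hr => hmin ⟨⟨r, rfl⟩, hr⟩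
  obtain ⟨z, A, hA⟩ := P.exists_symmetric_arc H S hb hX htM (Or.inl hmax')
  obtain ⟨z', B, hB⟩ := P.exists_symmetric_arc H S hb hX htm (Or.inr hmin')
  have hY := (H.symmetric_arc_unique S hb P.bound_pos hX A hA B hB).1
  exact ⟨_, z, A, hA, fun t ht => (hmax' t ht).antisymm (hY ▸ hmin' t ht)⟩

theorem HalfOrbit.image_eq (O : HalfOrbit f g b t₀ t₁ γ) (H : OddSystem f g d)
    (S : SignCondition f d a) (hb : b ∈ symInterval d) (hb0 : 0 < b) (hX : PotentialInverse g b X)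
    (A : Arc (transform f X) (-Y) Y z) (hA : ∀ s ∈ Icc (-Y) Y, z s < primitive g b)
    (hcross : ∀ t, (γ t).1 = 0 → |(γ t).2| = Y) :
    γ '' Icc t₀ t₁ = arcPoint X z '' Icc (-Y) Y := by
  obtain ⟨ζ, B, hB, himage⟩ := O.exists_arc H hb hX
  have hstart : (γ t₀).2 = Y := abs_of_pos O.start_snd ▸ hcross t₀ O.start_fst
  have hfinish : -(γ t₁).2 = Y := abs_of_neg O.finish_snd ▸ hcross t₁ O.finish_fst
  rw [hstart, hfinish] at B hB himage
  rw [himage]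
  refine image_congr fun s hs => ?_
  rw [arcPoint, arcPoint, (H.symmetric_arc_unique S hb hb0 hX A hA B hB).2 hs]

theorem PeriodicSolution.exists_range_eq_closedCurve (P : PeriodicSolution f g b T γ)
    (H : OddSystem f g d) (S : SignCondition f d a) (hb : b ∈ symInterval d)
    (hX : PotentialInverse g b X) :
    ∃ Y z, Arc (transform f X) (-Y) Y z ∧ (∀ s ∈ Icc (-Y) Y, z s < primitive g b) ∧
      range γ = closedCurve X z Y := by
  obtain ⟨Y, z, A, hA, hcross⟩ := P.exists_arc H S hb hX
  have hpos : ∀ {t₀ t₁}, HalfOrbit f g b t₀ t₁ γ →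
      γ '' Icc t₀ t₁ = arcPoint X z '' Icc (-Y) Y := fun O =>
    O.image_eq H S hb P.bound_pos hX A hA hcross
  have hneg : ∀ {t₀ t₁}, HalfOrbit f g b t₀ t₁ (-γ) →
      (-γ) '' Icc t₀ t₁ = arcPoint X z '' Icc (-Y) Y := fun O =>
    O.image_eq H S hb P.bound_pos hX A hA (by simpa using hcross)
  refine ⟨Y, z, A, hA, Subset.antisymm ?_ (union_subset ?_ ?_)⟩
  · rintro _ ⟨t, rfl⟩
    rcases P.exists_halfOrbit_mem H S hb t with ⟨t₀, t₁, O, ht⟩ | ⟨t₀, t₁, O, ht⟩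
    · exact Or.inl (hpos O ▸ mem_image_of_mem γ ht)
    · exact Or.inr (hneg O ▸ mem_image_of_mem (-γ) ht)
  · obtain ⟨t₀, t₁, O⟩ := P.exists_halfOrbit H S hb
    exact hpos O ▸ image_subset_range γ _
  · obtain ⟨t₀, t₁, O⟩ := (P.neg H hb).exists_halfOrbit H S hb
    rw [← hneg O]
    rintro Q ⟨t, -, ht⟩
    exact ⟨t, neg_injective ht⟩

theorem IsPeriodicOrbit.isCompact {V : ℝ × ℝ → ℝ × ℝ} {U C : Set (ℝ × ℝ)}
    (h : IsPeriodicOrbit V U C) : IsCompact C := by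
  obtain ⟨γ, hγ, ⟨T, hT, hper⟩, -, rfl⟩ := h
  exact hper.compact_of_continuous hT.ne'
    (continuous_iff_continuousAt.2 fun t => (hγ t).2.continuousAt)

theorem IsPeriodicOrbit.exists_isAmplitude {V : ℝ × ℝ → ℝ × ℝ} {U C : Set (ℝ × ℝ)}
    (h : IsPeriodicOrbit V U C) : ∃ A, IsAmplitude C A := by
  have hne : C.Nonempty := by
    obtain ⟨γ, -, -, -, rfl⟩ := h
    exact range_nonempty γ
  exact (h.isCompact.image continuous_fst.abs).exists_isGreatest (hne.image _)

theorem IsPeriodicOrbit.exists_periodicSolution {C : Set (ℝ × ℝ)}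
    (h : IsPeriodicOrbit (lienardField f g) (strip d) C) :
    ∃ b ∈ symInterval d, ∃ T γ, PeriodicSolution f g b T γ ∧ C = range γ := by
  obtain ⟨A, ⟨P, hP, rfl⟩, hA⟩ := h.exists_isAmplitude
  obtain ⟨γ, hγ, ⟨T, hT, hper⟩, hne, rfl⟩ := h
  obtain ⟨t, rfl⟩ := hP
  obtain ⟨b, hb, hlt⟩ := exists_gt_mem_symInterval
    (mem_symInterval_of_abs_le (hγ t).1 (abs_abs _).le)
  exact ⟨b, hb, T, γ, ⟨hT, fun s => (hA (mem_image_of_mem _ (mem_range_self s))).trans_lt hlt,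
    fun s => (hγ s).2, hper, hne⟩, rfl⟩

theorem OddSystem.periodicOrbit_unique (H : OddSystem f g d) (S : SignCondition f d a)
    {C C' : Set (ℝ × ℝ)} (h : IsPeriodicOrbit (lienardField f g) (strip d) C)
    (h' : IsPeriodicOrbit (lienardField f g) (strip d) C') : C = C' := by
  obtain ⟨b₁, hb₁, T, γ, P₁, rfl⟩ := h.exists_periodicSolution
  obtain ⟨b₂, hb₂, T', η, P₂, rfl⟩ := h'.exists_periodicSolution
  have P := P₁.mono (le_max_left b₁ b₂)
  have P' := P₂.mono (le_max_right b₁ b₂)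
  have hb : max b₁ b₂ ∈ symInterval d := max_rec' (· ∈ symInterval d) hb₁ hb₂
  obtain ⟨X, hX⟩ := H.exists_potentialInverse P.bound_pos.le hb
  obtain ⟨Y, z, A, hA, hγ⟩ := P.exists_range_eq_closedCurve H S hb hX
  obtain ⟨Y', z', B, hB, hη⟩ := P'.exists_range_eq_closedCurve H S hb hX
  obtain ⟨rfl, hzz'⟩ := H.symmetric_arc_unique S hb P.bound_pos hX A hA B hB
  have himage : arcPoint X z '' Icc (-Y) Y = arcPoint X z' '' Icc (-Y) Y :=
    image_congr fun s hs => by rw [arcPoint, arcPoint, hzz' hs]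
  rw [hγ, hη, closedCurve, closedCurve, himage]

end Uniqueness

section PhasePlane

variable {f g : ℝ → ℝ} {d : EReal} {α : ℝ} {C : Set (ℝ × ℝ)}

/-- The map from the Liénard plane to the phase plane: `y = x' + F(x)`. -/
def toPhase (f : ℝ → ℝ) : ℝ × ℝ ≃ ℝ × ℝ where
  toFun P := (P.1, P.2 - primitive f P.1)
  invFun P := (P.1, P.2 + primitive f P.1)
  left_inv _ := Prod.ext rfl (sub_add_cancel _ _)
  right_inv _ := Prod.ext rfl (add_sub_cancel_right _ _)

theorem IsPeriodicOrbit.image {V W : ℝ × ℝ → ℝ × ℝ} {U : Set (ℝ × ℝ)}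
    (h : IsPeriodicOrbit V U C) {φ : ℝ × ℝ → ℝ × ℝ} (hφ : Function.Injective φ)
    (hU : MapsTo φ U U) (hVW : ∀ γ : ℝ → ℝ × ℝ, ∀ t, γ t ∈ U → HasDerivAt γ (V (γ t)) t →
      HasDerivAt (φ ∘ γ) (W (φ (γ t))) t) : IsPeriodicOrbit W U (φ '' C) := by
  obtain ⟨γ, hγ, ⟨T, hT, hper⟩, hne, rfl⟩ := h
  exact ⟨φ ∘ γ, fun t => ⟨hU (hγ t).1, hVW γ t (hγ t).1 (hγ t).2⟩, ⟨T, hT, hper.comp φ⟩,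
    hne.imp fun _ => Exists.imp fun _ => hφ.ne, (range_comp φ γ).symm⟩

theorem OddSystem.isPeriodicOrbit_toPhase_image (H : OddSystem f g d)
    (h : IsPeriodicOrbit (lienardField f g) (strip d) C) :
    IsPeriodicOrbit (phaseField f g) (strip d) (toPhase f '' C) := by
  refine h.image (toPhase f).injective (fun _ hP => hP) fun γ t ht hγ => ?_
  have hx : HasDerivAt (fun t => (γ t).1) ((γ t).2 - primitive f (γ t).1) t := hγ.fst
  have hy : HasDerivAt (fun t => (γ t).2) (-g (γ t).1) t := hγ.snd
  refine (hx.prodMk (hy.sub ((H.hasDerivAt_F ht).comp t hx))).congr_deriv ?_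
  refine Prod.ext rfl ?_
  simp only [phaseField, toPhase, Equiv.coe_fn_mk]
  ring

theorem OddSystem.isPeriodicOrbit_toPhase_symm_image (H : OddSystem f g d)
    (h : IsPeriodicOrbit (phaseField f g) (strip d) C) :
    IsPeriodicOrbit (lienardField f g) (strip d) ((toPhase f).symm '' C) := by
  refine h.image (toPhase f).symm.injective (fun _ hP => hP) fun γ t ht hγ => ?_
  have hx : HasDerivAt (fun t => (γ t).1) (γ t).2 t := hγ.fst
  have hy : HasDerivAt (fun t => (γ t).2) (-f (γ t).1 * (γ t).2 - g (γ t).1) t := hγ.snd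
  refine (hx.prodMk (hy.add ((H.hasDerivAt_F ht).comp t hx))).congr_deriv ?_
  refine Prod.ext (add_sub_cancel_right _ _).symm ?_
  simp only [lienardField, toPhase, Equiv.coe_fn_symm_mk]
  ring

theorem existsUnique_limitCycle {V : ℝ × ℝ → ℝ × ℝ} {U : Set (ℝ × ℝ)}
    (h : IsPeriodicOrbit V U C) (hα : ∀ P ∈ C, |P.1| ≤ α)
    (huniq : ∀ C', IsPeriodicOrbit V U C' → C' = C) :
    (∃! C, IsLimitCycle V U C) ∧ ∀ C, IsLimitCycle V U C → ∃ A, IsAmplitude C A ∧ A ≤ α := by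
  refine ⟨⟨C, ⟨h, univ, isOpen_univ, subset_univ _, fun C' h' _ => huniq C' h'⟩,
    fun C' h' => huniq C' h'.1⟩, fun C' h' => ?_⟩
  obtain rfl := huniq C' h'.1
  obtain ⟨A, hA⟩ := h.exists_isAmplitude
  obtain ⟨P, hP, hPA⟩ := hA.1
  exact ⟨A, hA, hPA ▸ hα P hP⟩

end PhasePlane

section AlphaBar

variable {f g : ℝ → ℝ} {d : EReal} {a α y yp ym : ℝ}

theorem IsUpperIntercept.mem_symInterval (hp : IsUpperIntercept f g d α y) : α ∈ symInterval d := by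
  obtain ⟨-, T, γ, ⟨hT, hγ⟩, -, hγT, -⟩ := hp
  have hmem := (hγ T (right_mem_Icc.2 hT.le)).1
  rwa [hγT] at hmem

theorem IsAlphaBar.exists_intercepts (h : IsAlphaBar f g d α) :
    ∃ yp ym, IsUpperIntercept f g d α yp ∧ IsLowerIntercept f g d α ym ∧ -ym ≤ yp := by
  obtain ⟨-, yp, ym, hp, hm, hYQ, hQY'⟩ := h
  simp only [energy, primitive_zero] at hYQ hQY'
  exact ⟨yp, ym, hp, hm, (neg_le_abs ym).trans (abs_le_of_sq_le_sq (by linarith) hp.1.le)⟩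

theorem OddSystem.signCondition_of_isAlphaBar (H : OddSystem f g d) (ha : 0 < a)
    (had : (a : EReal) < d)
    (hFzero : ∀ x ∈ symInterval d, primitive f x = 0 ↔ x = 0 ∨ x = a ∨ x = -a)
    (hα : IsAlphaBar f g d α) (hl : MonotoneOn (primitive f) (Ioc a α))
    (hr : MonotoneOn (primitive f) {x : ℝ | α < x ∧ (x : EReal) < d}) : SignCondition f d a := by
  have had' : a ∈ symInterval d := (mem_symInterval_iff_of_nonneg ha.le).2 had
  obtain ⟨yp, ym, hp, -⟩ := hα.exists_intercepts
  obtain ⟨⟨α', -, hroot, -⟩, -⟩ := hα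
  have hne : ∀ x ∈ Ioo 0 a, primitive f x ≠ 0 := fun x hx h => by
    rcases (hFzero x (Icc_subset_symInterval had' (Ioo_subset_Icc_self hx))).1 h with h | h | h <;>
      linarith [hx.1, hx.2]
  refine H.signCondition ha had' ((hFzero a had').2 (Or.inr (Or.inl rfl))) hne hroot ?_
  refine monotoneOn_inter_Ici_of_Ioc_of_Ioi (isOpen_symInterval d) had' hp.mem_symInterval
    H.continuousOn_F hl (hr.mono fun x hx => ⟨hx.2, ?_⟩)
  exact (mem_symInterval_iff_of_nonneg (hp.pos.trans hx.2).le).1 hx.1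

end AlphaBar

end Lienard

end

theorem mainTheorem3_general {f g : ℝ → ℝ} {d : EReal} {a α yp ym : ℝ}
    (H : Lienard.OddSystem f g d) (S : Lienard.SignCondition f d a)
    (hp : Lienard.IsUpperIntercept f g d α yp) (hm : Lienard.IsLowerIntercept f g d α ym)
    (hle : -ym ≤ yp) :
    ((∃! C, Lienard.IsLimitCycle (Lienard.lienardField f g) (Lienard.strip d) C) ∧
      ∀ C, Lienard.IsLimitCycle (Lienard.lienardField f g) (Lienard.strip d) C →
        ∃ A, Lienard.IsAmplitude C A ∧ A ≤ α) ∧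
    ((∃! C, Lienard.IsLimitCycle (Lienard.phaseField f g) (Lienard.strip d) C) ∧
      ∀ C, Lienard.IsLimitCycle (Lienard.phaseField f g) (Lienard.strip d) C →
        ∃ A, Lienard.IsAmplitude C A ∧ A ≤ α) := by
  obtain ⟨C, hC, hCα⟩ := H.exists_periodicOrbit S hp hm hle
  refine ⟨Lienard.existsUnique_limitCycle hC hCα fun C' h => H.periodicOrbit_unique S h hC,
    Lienard.existsUnique_limitCycle (H.isPeriodicOrbit_toPhase_image hC)
      (forall_mem_image.2 hCα) fun C' h => ?_⟩
  rw [← H.periodicOrbit_unique S (H.isPeriodicOrbit_toPhase_symm_image h) hC,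
    Equiv.image_symm_image]

theorem mainTheorem3 (f g : ℝ → ℝ) (d : EReal) (a αbar : ℝ)
    (hf : ContinuousOn f (Lienard.symInterval d))
    (hg : ContinuousOn g (Lienard.symInterval d))
    (hFodd : ∀ x ∈ Lienard.symInterval d,
      Lienard.primitive f (-x) = -Lienard.primitive f x)
    (hgodd : ∀ x ∈ Lienard.symInterval d, g (-x) = -g x)
    (hgpos : ∀ x ∈ Lienard.symInterval d, 0 < x → 0 < g x)
    (ha : 0 < a) (had : (a : EReal) < d)
    (hFzero : ∀ x ∈ Lienard.symInterval d,
      Lienard.primitive f x = 0 ↔ x = 0 ∨ x = a ∨ x = -a)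
    (hαbar : Lienard.IsAlphaBar f g d αbar)
    (hFinc : StrictMonoOn (Lienard.primitive f) (Set.Ioc a αbar))
    (hFmono : MonotoneOn (Lienard.primitive f) {x : ℝ | αbar < x ∧ (x : EReal) < d}) :
    ((∃! C, Lienard.IsLimitCycle (Lienard.lienardField f g) (Lienard.strip d) C) ∧
      ∀ C, Lienard.IsLimitCycle (Lienard.lienardField f g) (Lienard.strip d) C →
        ∃ A, Lienard.IsAmplitude C A ∧ A ≤ αbar) ∧
    ((∃! C, Lienard.IsLimitCycle (Lienard.phaseField f g) (Lienard.strip d) C) ∧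
      ∀ C, Lienard.IsLimitCycle (Lienard.phaseField f g) (Lienard.strip d) C →
        ∃ A, Lienard.IsAmplitude C A ∧ A ≤ αbar) := by
  have H : Lienard.OddSystem f g d := ⟨hf, hg, hFodd, hgodd, hgpos⟩
  obtain ⟨yp, ym, hp, hm, hle⟩ := hαbar.exists_intercepts
  exact mainTheorem3_general H
    (H.signCondition_of_isAlphaBar ha had hFzero hαbar hFinc.monotoneOn hFmono) hp hm hle
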